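/- Let $n\ge 1$ be an integer and $Y:=(0,1)^n$. A function on $\mathbb{R}^n$ is called $Y$-periodic if it is invariant under translations by $\mathbb{Z}^n$. $L^p_{\mathrm{per}}(Y)$ denotes the space of $Y$-periodic functions whose restriction to $Y$ is in $L^p(Y)$; $H^k_{\mathrm{per}}(Y)$ is the space of functions in $L^2_{\mathrm{per}}(Y)$ whose weak derivatives up to order $k$ (with respect to smooth $Y$-periodic test functions) are in $L^2_{\mathrm{per}}(Y)$; and $H^1_{\mathrm{per},0}(Y;\mathbb{R}^n)$ is the space of $w\in H^1_{\mathrm{per}}(Y;\mathbb{R}^n)$ with $\int_Y w=0$. Functions are identified if they agree almost everywhere. We write $M:N=\sum_{i,j}M_{ij}N_{ij}$, $|M|^2=M:M$, and $(Dw)_{ij}=\partial_j w_i$. Let $A\in L^\infty_{\mathrm{per}}(Y;\mathbb{R}^{n\times n}_{\mathrm{sym}})$ and $b\in L^\infty_{\mathrm{per}}(Y;\mathbb{R}^n)$. Suppose that there are $\lambda,\Lambda>0$ with $\lambda I_n\le A\le\Lambda I_n$ a.e. in $\mathbb{R}^n$, and that there is $\delta\in\left(\frac{n}{n+\pi^2},1\right]$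 with $$\frac{|A|^2+|b|^2}{(\mathrm{tr}(A))^2}\le\frac{1}{n-1+\delta}\quad\text{a.e. in }\mathbb{R}^n.$$ Let $F\in L^2_{\mathrm{per}}(Y;\mathbb{R}^n)$, and set $\gamma:=\frac{\mathrm{tr}(A)}{|A|^2+|b|^2}$, $\tilde A:=\gamma A$, $\tilde b:=\gamma b$. For $G\in L^2_{\mathrm{per}}(Y;\mathbb{R}^n)$, a function $u\in L^2_{\mathrm{per}}(Y)$ is called a solution of $$-D^2:(\tilde A u)+\nabla\cdot(\tilde b u)=\nabla\cdot G\quad\text{in }Y,\qquad u\ \ Y\text{-periodic},\tag{$P_G$}$$ if $$\int_Y u\,\tilde A:D^2\varphi+\int_Y u\,\tilde b\cdot\nabla\varphi=\int_Y G\cdot\nabla\varphi\qquad\text{for all }\varphi\in H^2_{\mathrm{per}}(Y).$$ For $v,w\in H^1_{\mathrm{per},0}(Y;\mathbb{R}^n)$ let $$B_2(v,w):=\int_Y(\nabla\cdot v)\left(\tilde A:Dw+\tilde b\cdot w\right)+\frac12\int_Y\left(Dv-(Dv)^{\mathrm T}\right):\left(Dw-(Dw)^{\mathrm T}\right).$$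 There is a unique solution $\tilde r\in L^2_{\mathrm{per}}(Y)$ of $(P_0)$ with $\int_Y\tilde r=1$, and the following assertions hold. (i) There exists a unique $\tilde\rho_0\in H^1_{\mathrm{per},0}(Y;\mathbb{R}^n)$ such that $B_2(\tilde\rho_0,w)=-\int_Y F\cdot w$ for all $w\in H^1_{\mathrm{per},0}(Y;\mathbb{R}^n)$. (ii) The function $\tilde u_0:=-\nabla\cdot\tilde\rho_0$ is the unique solution in $L^2_{\mathrm{per}}(Y)$ of $(P_F)$ with $\int_Y\tilde u_0=0$. (iii) A function $\tilde u\in L^2_{\mathrm{per}}(Y)$ is a solution of $(P_F)$ if and only if $\tilde u=\tilde u_0+c\,\tilde r$ for some constant $c\in\mathbb{R}$. -/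

import Mathlib

open MeasureTheory Matrix
open scoped ContDiff

namespace CordesFPK

/-- The unit cell `Y = (0,1)^n`. Points of `ℝ^n` are written as `Fin n → ℝ`; the norm of this type
is never used, only its Lebesgue measure and its smooth structure. -/
def unitCell (n : ℕ) : Set (Fin n → ℝ) := Set.univ.pi fun _ => Set.Ioo (0 : ℝ) 1

/-- `Y`-periodicity: invariance under translation by `ℤ^n`. -/
def YPeriodic {n : ℕ} {α : Type*} (f : (Fin n → ℝ) → α) : Prop :=
  ∀ (x : Fin n → ℝ) (k : Fin n → ℤ), f (x + fun i => (k i : ℝ)) = f x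

/-- `f ∈ L^p_per(Y)`: the function is `Y`-periodic and its restriction to `Y` is in `L^p(Y)`.
Functions are representatives of their almost everywhere classes. -/
def MemLpPer {n : ℕ} (p : ENNReal) (f : (Fin n → ℝ) → ℝ) : Prop :=
  YPeriodic f ∧ MemLp f p (volume.restrict (unitCell n))

/-- The classical partial derivative `∂_i φ (x)`. -/
noncomputable def classicalPartial {n : ℕ} (i : Fin n) (φ : (Fin n → ℝ) → ℝ) (x : Fin n → ℝ) : ℝ :=
  fderiv ℝ φ x (Pi.single i 1)

/-- `g` is a weak partial derivative `∂_i u` of the `Y`-periodic function `u`: integration by parts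
holds against every test function in `C^∞_per(Y)`. -/
def HasWeakPartial {n : ℕ} (i : Fin n) (u g : (Fin n → ℝ) → ℝ) : Prop :=
  ∀ φ : (Fin n → ℝ) → ℝ, ContDiff ℝ ∞ φ → YPeriodic φ →
    ∫ x in unitCell n, u x * classicalPartial i φ x = - ∫ x in unitCell n, g x * φ x

/-- `u` has a weak partial derivative `∂_i u` in `L^2_per(Y)`. -/
def HasL2WeakPartial {n : ℕ} (i : Fin n) (u : (Fin n → ℝ) → ℝ) : Prop :=
  ∃ g : (Fin n → ℝ) → ℝ, MemLpPer 2 g ∧ HasWeakPartial i u g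

open Classical in
/-- A representative in `L^2_per(Y)` of the weak partial derivative `∂_i u` (which is unique up to
almost everywhere equality), if there is one. -/
noncomputable def weakPartial {n : ℕ} (i : Fin n) (u : (Fin n → ℝ) → ℝ) : (Fin n → ℝ) → ℝ :=
  if h : HasL2WeakPartial i u then h.choose else 0

/-- `u ∈ H^1_per(Y)`. -/
def MemH1Per {n : ℕ} (u : (Fin n → ℝ) → ℝ) : Prop :=
  MemLpPer 2 u ∧ ∀ i, HasL2WeakPartial i u

/-- `u ∈ H^2_per(Y)`. -/
def MemH2Per {n : ℕ} (u : (Fin n → ℝ) → ℝ) : Prop :=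
  MemH1Per u ∧ ∀ i, MemH1Per (weakPartial i u)

/-- `F ∈ L^2_per(Y; ℝ^n)`. -/
def MemL2PerVec {n : ℕ} (F : (Fin n → ℝ) → (Fin n → ℝ)) : Prop :=
  ∀ i, MemLpPer 2 (fun x => F x i)

/-- `w ∈ H^1_{per,0}(Y; ℝ^n)`: every component is in `H^1_per(Y)` and has mean zero. -/
def MemH1PerZeroVec {n : ℕ} (w : (Fin n → ℝ) → (Fin n → ℝ)) : Prop :=
  ∀ i, MemH1Per (fun x => w x i) ∧ ∫ x in unitCell n, w x i = 0

/-- The weak gradient `∇φ`. -/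
noncomputable def weakGrad {n : ℕ} (φ : (Fin n → ℝ) → ℝ) (x : Fin n → ℝ) : Fin n → ℝ :=
  fun i => weakPartial i φ x

/-- The weak Hessian `D²φ`. -/
noncomputable def weakHess {n : ℕ} (φ : (Fin n → ℝ) → ℝ) (x : Fin n → ℝ) :
    Matrix (Fin n) (Fin n) ℝ :=
  Matrix.of fun i j => weakPartial j (weakPartial i φ) x

/-- The weak Jacobian `Dw`, with entries `(Dw)_{ij} = ∂_j w_i`. -/
noncomputable def weakJac {n : ℕ} (w : (Fin n → ℝ) → (Fin n → ℝ)) (x : Fin n → ℝ) :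
    Matrix (Fin n) (Fin n) ℝ :=
  Matrix.of fun i j => weakPartial j (fun y => w y i) x

/-- The weak divergence `∇·w`. -/
noncomputable def weakDiv {n : ℕ} (w : (Fin n → ℝ) → (Fin n → ℝ)) (x : Fin n → ℝ) : ℝ :=
  ∑ i, weakPartial i (fun y => w y i) x

/-- The Frobenius product `M : N`. -/
def frob {n : ℕ} (M N : Matrix (Fin n) (Fin n) ℝ) : ℝ := ∑ i, ∑ j, M i j * N i j

/-- The setting `𝓑`: bounded measurable periodic coefficients with `A` symmetric and uniformly
elliptic, subject to the Cordes-type condition. -/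
structure SettingB {n : ℕ} (A : (Fin n → ℝ) → Matrix (Fin n) (Fin n) ℝ)
    (b : (Fin n → ℝ) → (Fin n → ℝ)) : Prop where
  bounded_A : ∀ i j, MemLpPer ⊤ (fun x => A x i j)
  bounded_b : ∀ i, MemLpPer ⊤ (fun x => b x i)
  symm : ∀ᵐ x, (A x).IsSymm
  elliptic : ∃ lam Lam : ℝ, 0 < lam ∧ 0 < Lam ∧ ∀ᵐ x, ∀ ξ : Fin n → ℝ,
    lam * (ξ ⬝ᵥ ξ) ≤ ξ ⬝ᵥ (A x *ᵥ ξ) ∧ ξ ⬝ᵥ (A x *ᵥ ξ) ≤ Lam * (ξ ⬝ᵥ ξ)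
  cordes : ∃ δ : ℝ, (n : ℝ) / (n + Real.pi ^ 2) < δ ∧ δ ≤ 1 ∧ ∀ᵐ x,
    (frob (A x) (A x) + b x ⬝ᵥ b x) / (A x).trace ^ 2 ≤ 1 / ((n : ℝ) - 1 + δ)

/-- The renormalization function `γ = tr(A) / (|A|² + |b|²)`. -/
noncomputable def gam {n : ℕ} (A : (Fin n → ℝ) → Matrix (Fin n) (Fin n) ℝ)
    (b : (Fin n → ℝ) → (Fin n → ℝ)) (x : Fin n → ℝ) : ℝ :=
  (A x).trace / (frob (A x) (A x) + b x ⬝ᵥ b x)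

/-- The renormalized diffusion matrix `Ã = γ A`. -/
noncomputable def renormA {n : ℕ} (A : (Fin n → ℝ) → Matrix (Fin n) (Fin n) ℝ)
    (b : (Fin n → ℝ) → (Fin n → ℝ)) (x : Fin n → ℝ) : Matrix (Fin n) (Fin n) ℝ :=
  gam A b x • A x

/-- The renormalized drift `b̃ = γ b`. -/
noncomputable def renormB {n : ℕ} (A : (Fin n → ℝ) → Matrix (Fin n) (Fin n) ℝ)
    (b : (Fin n → ℝ) → (Fin n → ℝ)) (x : Fin n → ℝ) : Fin n → ℝ :=
  gam A b x • b x

/-- `u ∈ L^2_per(Y)` is a (very weak) solution of `-D²:(Au) + ∇·(bu) = ∇·F` in `Y`, `u` being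
`Y`-periodic: all derivatives are moved onto test functions in `H^2_per(Y)`. -/
def IsFPKSolution {n : ℕ} (A : (Fin n → ℝ) → Matrix (Fin n) (Fin n) ℝ)
    (b F : (Fin n → ℝ) → (Fin n → ℝ)) (u : (Fin n → ℝ) → ℝ) : Prop :=
  MemLpPer 2 u ∧ ∀ φ : (Fin n → ℝ) → ℝ, MemH2Per φ →
    (∫ x in unitCell n, u x * frob (A x) (weakHess φ x))
      + (∫ x in unitCell n, u x * (b x ⬝ᵥ weakGrad φ x))
      = ∫ x in unitCell n, F x ⬝ᵥ weakGrad φ x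

/-- The bilinear form
`B₂(v,w) = ∫_Y (∇·v)(Ã:Dw + b̃·w) + 1/2 ∫_Y (Dv - (Dv)ᵀ):(Dw - (Dw)ᵀ)`,
in which `Ã`, `b̃` are the renormalizations of `A`, `b`. -/
noncomputable def B2 {n : ℕ} (A : (Fin n → ℝ) → Matrix (Fin n) (Fin n) ℝ)
    (b v w : (Fin n → ℝ) → (Fin n → ℝ)) : ℝ :=
  (∫ x in unitCell n, weakDiv v x *
      (frob (renormA A b x) (weakJac w x) + renormB A b x ⬝ᵥ w x))
    + 1 / 2 * ∫ x in unitCell n,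
      frob (weakJac v x - (weakJac v x)ᵀ) (weakJac w x - (weakJac w x)ᵀ)

/-- `r` is a solution in `L^2_per(Y)` of the renormalized homogeneous problem
`-D²:(Ãr) + ∇·(b̃r) = 0` with `∫_Y r = 1`. -/
def IsRenormInvariant {n : ℕ} (A : (Fin n → ℝ) → Matrix (Fin n) (Fin n) ℝ)
    (b : (Fin n → ℝ) → (Fin n → ℝ)) (r : (Fin n → ℝ) → ℝ) : Prop :=
  IsFPKSolution (renormA A b) (renormB A b) 0 r ∧ ∫ x in unitCell n, r x = 1

/-- `ρ ∈ H^1_{per,0}(Y; ℝ^n)` satisfies `B₂(ρ,w) = -∫_Y F·w` for all `w ∈ H^1_{per,0}(Y; ℝ^n)`. -/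
def IsAuxSolution {n : ℕ} (A : (Fin n → ℝ) → Matrix (Fin n) (Fin n) ℝ)
    (b F ρ : (Fin n → ℝ) → (Fin n → ℝ)) : Prop :=
  MemH1PerZeroVec ρ ∧ ∀ w : (Fin n → ℝ) → (Fin n → ℝ), MemH1PerZeroVec w →
    B2 A b ρ w = - ∫ x in unitCell n, F x ⬝ᵥ w x

end CordesFPK

open CordesFPK

/-! Write L w = Ã:Dw + b̃·w. At almost every point γ(A, b) is the multiple of (A, b) nearest to (I,
0), and the Cordes condition bounds the squared distance by 1 - δ (`sum_renorm_sub_sq_le`). Hence L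
is a small perturbation of the divergence: ‖Lw - ∇·w‖² ≤ (1-δ)(‖w‖² + ‖Dw‖²). For periodic w of mean
zero, ‖Dw‖² = ‖∇·w‖² + ½‖Dw - (Dw)ᵀ‖² (`sum_norm_jacobian_sq`) and 4π²‖w‖² ≤ ‖Dw‖²
(`poincare_inequality`). Therefore B₂(w,w) = ‖Dw‖² + ⟨∇·w, Lw - ∇·w⟩ ≥ (1-θ)‖Dw‖² with θ² = (1-δ)(1
+ 1/(4π²)) < 1. This is coercivity (`isCoercive_jetForm`), and Lax–Milgram yields (i).

Gradients link B₂ to the scalar equation. The Jacobian of ∇φ is symmetric, so B₂(ρ,∇φ) = ⟨∇·ρ, L∇φ⟩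
(`B2_weakGrad`), and -∇·ρ solves the equation when ρ solves the auxiliary problem. With right-hand
side ∫ L w instead, 1 - ∇·ρ is the invariant function. For uniqueness, the difference of two
solutions of equal mean is Δφ for some φ (`exists_memH2Per_jetDiv_eq`); then B₂(∇φ,∇φ) = 0, so ∇φ =
0 (`IsFPKSolution.ae_eq`). Assertion (iii) is then linearity plus a comparison of means.

Weak derivatives are handled as Fourier multipliers (`hasWeakPartial_iff`), which turns each fact
about periodic functions used above into a statement about symbols. -/

namespace CordesFPK
open scoped ComplexConjugate InnerProductSpace
noncomputable section

/-! ### The unit cell, the torus and the Fourier basis. -/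

/-- Lebesgue measure on the unit cell. -/
abbrev cellMeasure (n : ℕ) : Measure (Fin n → ℝ) := volume.restrict (unitCell n)

lemma measurableSet_unitCell (n : ℕ) : MeasurableSet (unitCell n) :=
  MeasurableSet.univ_pi fun _ => measurableSet_Ioo

instance (n : ℕ) : IsProbabilityMeasure (cellMeasure n) :=
  ⟨by simp [cellMeasure, unitCell, Real.volume_pi_Ioo]⟩

/-- The faces are null sets, and the half-open cube is the fundamental domain that maps bijectively
onto the torus. -/
lemma cellMeasure_eq_Ioc (n : ℕ) :
    cellMeasure n = volume.restrict (Set.univ.pi fun _ : Fin n => Set.Ioc (0 : ℝ) 1) :=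
  Measure.restrict_congr_set
    ((Measure.univ_pi_Ioo_ae_eq_Icc (μ := fun _ : Fin n => (volume : Measure ℝ))
      (f := fun _ => (0 : ℝ)) (g := fun _ => 1)).trans
      (Measure.univ_pi_Ioc_ae_eq_Icc (μ := fun _ : Fin n => (volume : Measure ℝ))
      (f := fun _ => (0 : ℝ)) (g := fun _ => 1)).symm)

/-- The normalised Haar measure on the torus. -/
abbrev torusMeasure (n : ℕ) : Measure (UnitAddTorus (Fin n)) :=
  Measure.pi fun _ => AddCircle.haarAddCircle

/-- The covering map of the torus. -/
def toTorus {n : ℕ} (x : Fin n → ℝ) : UnitAddTorus (Fin n) := fun i => (x i : UnitAddCircle)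

lemma measurePreserving_toTorus (n : ℕ) :
    MeasurePreserving (toTorus (n := n)) (cellMeasure n) (torusMeasure n) := by
  have h : MeasurePreserving (fun x : ℝ => (x : UnitAddCircle))
      (volume.restrict (Set.Ioc (0 : ℝ) 1)) AddCircle.haarAddCircle := by
    have := UnitAddCircle.measurePreserving_mk 0
    rw [zero_add] at this
    convert this using 1
    simp [volume, AddCircle.haarAddCircle]
  have := measurePreserving_pi (fun _ : Fin n => volume.restrict (Set.Ioc (0 : ℝ) 1))
    (fun _ : Fin n => (AddCircle.haarAddCircle : Measure UnitAddCircle)) (fun _ => h)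
  rw [← Measure.restrict_pi_pi (fun _ => volume)] at this
  rw [cellMeasure_eq_Ioc]
  exact this

/-- The section of the covering map with values in `(0,1]^n`. -/
def ofTorus {n : ℕ} (y : UnitAddTorus (Fin n)) : Fin n → ℝ :=
  fun i => (AddCircle.measurableEquivIoc (1 : ℝ) 0 (y i) : ℝ)

lemma measurable_ofTorus (n : ℕ) : Measurable (ofTorus (n := n)) :=
  measurable_pi_lambda _ fun i => measurable_subtype_coe.comp
    ((AddCircle.measurableEquivIoc (1 : ℝ) 0).measurable.comp (measurable_pi_apply i))

lemma ofTorus_toTorus {n : ℕ} {x : Fin n → ℝ} (hx : x ∈ unitCell n) :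
    ofTorus (toTorus x) = x := by
  funext i
  have h : x i ∈ Set.Ioc (0 : ℝ) (0 + 1) := by
    have := hx i trivial
    exact ⟨this.1, by simpa using this.2.le⟩
  change ((AddCircle.equivIoc (1 : ℝ) 0 (x i : UnitAddCircle) : ℝ)) = x i
  have h2 := (AddCircle.equivIoc (1 : ℝ) 0).apply_symm_apply ⟨x i, h⟩
  exact congrArg Subtype.val h2

lemma measurePreserving_ofTorus (n : ℕ) :
    MeasurePreserving (ofTorus (n := n)) (torusMeasure n) (cellMeasure n) := by
  refine ⟨measurable_ofTorus n, ?_⟩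
  rw [← (measurePreserving_toTorus n).map_eq,
    Measure.map_map (measurable_ofTorus n) (measurePreserving_toTorus n).measurable]
  have : (ofTorus ∘ toTorus : (Fin n → ℝ) → _) =ᵐ[cellMeasure n] id := by
    filter_upwards [ae_restrict_mem (measurableSet_unitCell n)] with x hx
    exact ofTorus_toTorus hx
  rw [Measure.map_congr this, Measure.map_id]

/-- Composition with the covering map, as a unitary map between the `L²` spaces. -/
def torusIso (n : ℕ) : Lp ℂ 2 (torusMeasure n) ≃ₗᵢ[ℂ] Lp ℂ 2 (cellMeasure n) :=
  LinearIsometryEquiv.ofSurjective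
    (Lp.compMeasurePreservingₗᵢ ℂ toTorus (measurePreserving_toTorus n)) fun f => by
      refine ⟨Lp.compMeasurePreserving ofTorus (measurePreserving_ofTorus n) f, ?_⟩
      apply Lp.ext
      change (Lp.compMeasurePreserving toTorus (measurePreserving_toTorus n) _ : _) =ᵐ[_] _
      refine (Lp.coeFn_compMeasurePreserving _ (measurePreserving_toTorus n)).trans ?_
      refine ((measurePreserving_toTorus n).quasiMeasurePreserving.ae_eq_comp
        (Lp.coeFn_compMeasurePreserving f (measurePreserving_ofTorus n))).trans ?_
      filter_upwards [ae_restrict_mem (measurableSet_unitCell n)] with x hx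
      simp [ofTorus_toTorus hx]

/-- The character `x ↦ exp (2πi k·x)`. -/
def character {n : ℕ} (k : Fin n → ℤ) (x : Fin n → ℝ) : ℂ :=
  Complex.exp (2 * Real.pi * Complex.I * ∑ j, (k j : ℂ) * (x j : ℂ))

lemma conj_character {n : ℕ} (k : Fin n → ℤ) (x : Fin n → ℝ) :
    conj (character k x) = character (-k) x := by
  have h : ∀ m : ℤ, conj (m : ℂ) = m := fun m => map_intCast _ m
  simp only [character, map_mul, Complex.conj_ofReal, ← Complex.exp_conj, map_sum,
    Complex.conj_I, map_ofNat, Pi.neg_apply, Int.cast_neg, neg_mul, Finset.sum_neg_distrib,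
    mul_neg, h]

lemma mFourier_toTorus {n : ℕ} (k : Fin n → ℤ) (x : Fin n → ℝ) :
    UnitAddTorus.mFourier k (toTorus x) = character k x := by
  simp only [UnitAddTorus.mFourier, ContinuousMap.coe_mk, toTorus, character, Finset.mul_sum,
    Complex.exp_sum]
  refine Finset.prod_congr rfl fun i _ => ?_
  rw [fourier_coe_apply]
  congr 1
  push_cast
  ring

/-- The Fourier basis of `L²(Y)`. -/
def cellBasis (n : ℕ) : HilbertBasis (Fin n → ℤ) ℂ (Lp ℂ 2 (cellMeasure n)) :=
  HilbertBasis.ofRepr ((torusIso n).symm.trans (UnitAddTorus.mFourierBasis (d := Fin n)).repr)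

lemma coeFn_cellBasis {n : ℕ} (k : Fin n → ℤ) :
    cellBasis n k =ᵐ[cellMeasure n] character k := by
  have h : cellBasis n k = torusIso n (UnitAddTorus.mFourierLp 2 k) := by
    rw [← UnitAddTorus.coe_mFourierBasis]
    rfl
  rw [h]
  refine (Lp.coeFn_compMeasurePreserving _ (measurePreserving_toTorus n)).trans ?_
  refine ((measurePreserving_toTorus n).quasiMeasurePreserving.ae_eq_comp
        (UnitAddTorus.coeFn_mFourierLp 2 k)).trans ?_
  exact Filter.Eventually.of_forall fun x => mFourier_toTorus k x

/-! ### Fourier coefficients of real square integrable functions. -/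

/-- The `k`-th Fourier coefficient of a real square integrable function. -/
def fourierCf {n : ℕ} (k : Fin n → ℤ) : Lp ℝ 2 (cellMeasure n) →L[ℝ] ℂ :=
  ((innerSL ℂ (cellBasis n k)).restrictScalars ℝ).comp
    (Complex.ofRealCLM.compLpL 2 (cellMeasure n))

variable {n : ℕ}

lemma fourierCf_eq_integral (k : Fin n → ℤ) (u : Lp ℝ 2 (cellMeasure n)) :
    fourierCf k u = ∫ x, (u x : ℂ) * conj (character k x) ∂(cellMeasure n) := by
  change ⟪cellBasis n k, Complex.ofRealCLM.compLpL 2 (cellMeasure n) u⟫_ℂ = _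
  rw [L2.inner_def]
  refine integral_congr_ae ?_
  filter_upwards [coeFn_cellBasis k, Complex.ofRealCLM.coeFn_compLpL (p := 2) u] with x h1 h2
  rw [h1, h2]
  simp [mul_comm]

/-- Parseval's identity, polarised; it reduces identities between inner products to identities
between symbols. -/
lemma hasSum_fourierCf_mul (u v : Lp ℝ 2 (cellMeasure n)) :
    HasSum (fun k => conj (fourierCf k u) * fourierCf k v) ((⟪u, v⟫_ℝ : ℝ) : ℂ) := by
  have h := (cellBasis n).hasSum_inner_mul_inner (Complex.ofRealCLM.compLpL 2 (cellMeasure n) u)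
    (Complex.ofRealCLM.compLpL 2 (cellMeasure n) v)
  have e : ⟪Complex.ofRealCLM.compLpL 2 (cellMeasure n) u,
      Complex.ofRealCLM.compLpL 2 (cellMeasure n) v⟫_ℂ = ((⟪u, v⟫_ℝ : ℝ) : ℂ) := by
    rw [L2.inner_def, L2.inner_def, ← integral_complex_ofReal]
    refine integral_congr_ae ?_
    filter_upwards [Complex.ofRealCLM.coeFn_compLpL (p := 2) u,
      Complex.ofRealCLM.coeFn_compLpL (p := 2) v] with x h1 h2
    rw [h1, h2]
    simp
  rw [e] at h
  refine Eq.mpr ?_ h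
  congr 1
  funext k
  rw [← inner_conj_symm]
  rfl

lemma fourierCf_injective {u v : Lp ℝ 2 (cellMeasure n)}
    (h : ∀ k, fourierCf k u = fourierCf k v) : u = v := by
  have h0 := hasSum_fourierCf_mul (u - v) (u - v)
  simp only [map_sub, h, sub_self, mul_zero] at h0
  have := h0.unique hasSum_zero
  rw [Complex.ofReal_eq_zero, inner_self_eq_zero] at this
  exact sub_eq_zero.mp this

lemma hasSum_norm_fourierCf_sq (u : Lp ℝ 2 (cellMeasure n)) :
    HasSum (fun k => ‖fourierCf k u‖ ^ 2) (‖u‖ ^ 2) := by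
  have h := hasSum_fourierCf_mul u u
  rw [real_inner_self_eq_norm_sq] at h
  rw [← Complex.hasSum_ofReal]
  convert h using 2 with k
  rw [Complex.conj_mul']
  push_cast
  rfl

lemma fourierCf_neg (k : Fin n → ℤ) (u : Lp ℝ 2 (cellMeasure n)) :
    fourierCf (-k) u = conj (fourierCf k u) := by
  rw [fourierCf_eq_integral, fourierCf_eq_integral, ← integral_conj]
  congr 1 with x
  simp only [map_mul, Complex.conj_ofReal, conj_character, neg_neg]

/-- Riesz–Fischer produces a complex function; Hermitian symmetry of the coefficients ensures that
passing to its real part does not change them. -/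
lemma exists_fourierCf_eq {c : (Fin n → ℤ) → ℂ} (hc : Memℓp c 2)
    (hsymm : ∀ k, c (-k) = conj (c k)) :
    ∃ u : Lp ℝ 2 (cellMeasure n), ∀ k, fourierCf k u = c k := by
  let f : Lp ℂ 2 (cellMeasure n) := (cellBasis n).repr.symm ⟨c, hc⟩
  have hf : ∀ k, ∫ x, f x * conj (character k x) ∂(cellMeasure n) = c k := by
    intro k
    have h1 : (cellBasis n).repr f k = c k := by
      simp only [f, LinearIsometryEquiv.apply_symm_apply]
    rw [← h1, HilbertBasis.repr_apply_apply, L2.inner_def]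
    refine integral_congr_ae ?_
    filter_upwards [coeFn_cellBasis k] with x h1
    rw [h1]
    simp [mul_comm]
  have hint : ∀ k, Integrable (fun x => f x * conj (character k x)) (cellMeasure n) := by
    intro k
    refine (L2.integrable_inner (𝕜 := ℂ) (cellBasis n k) f).congr ?_
    filter_upwards [coeFn_cellBasis k] with x h1
    rw [h1]
    simp [mul_comm]
  have hneg : ∀ k x, conj (character (n := n) (-k) x) = character k x := by
    intro k x
    rw [conj_character, neg_neg]
  refine ⟨Complex.reCLM.compLpL 2 (cellMeasure n) f, fun k => ?_⟩
  -- Since Re f = (f + conj f)/2, the coefficient at k averages that of f at k and the conjugate of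
  -- that of f at -k.
  have e : fourierCf k (Complex.reCLM.compLpL 2 (cellMeasure n) f) =
      ∫ x, (1 / 2 : ℂ) * (f x * conj (character k x) + conj (f x * conj (character (-k) x)))
        ∂(cellMeasure n) := by
    rw [fourierCf_eq_integral]
    refine integral_congr_ae ?_
    filter_upwards [Complex.reCLM.coeFn_compLpL (p := 2) f] with x hx
    rw [hx, map_mul, hneg, ← add_mul]
    rw [Complex.add_conj]
    simp
    ring
  rw [e, integral_const_mul, integral_add (hint k), integral_conj, hf, hf, hsymm]
  · simp; ring
  · exact (Complex.conjCLE.integrable_comp_iff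
      (φ := fun x => f x * conj (character (-k) x))).mpr (hint (-k))

/-! ### Smooth periodic functions and their derivatives. -/

lemma ae_mem_unitCell (n : ℕ) : ∀ᵐ x ∂(cellMeasure n), x ∈ unitCell n :=
  ae_restrict_mem (measurableSet_unitCell n)

lemma memLp_of_continuous {E : Type*} [NormedAddCommGroup E] {f : (Fin n → ℝ) → E}
    (hf : Continuous f) (p : ENNReal) : MemLp f p (cellMeasure n) := by
  obtain ⟨C, hC⟩ := (isCompact_univ_pi fun _ : Fin n => isCompact_Icc (a := (0 : ℝ)) (b := 1))
    |>.exists_bound_of_continuousOn hf.continuousOn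
  refine MemLp.of_bound hf.aestronglyMeasurable C ?_
  filter_upwards [ae_mem_unitCell n] with x hx
  exact hC x fun i _ => Set.Ioo_subset_Icc_self (hx i trivial)

lemma continuous_classicalPartial {φ : (Fin n → ℝ) → ℝ} (hφ : ContDiff ℝ ∞ φ) (i : Fin n) :
    Continuous (classicalPartial i φ) :=
  (hφ.continuous_fderiv (by simp)).clm_apply continuous_const

/-- The integral of a partial derivative of a smooth periodic function vanishes. -/
lemma integral_classicalPartial_eq_zero {φ : (Fin n → ℝ) → ℝ} (hφ : ContDiff ℝ ∞ φ)
    (hper : YPeriodic φ) (i : Fin n) : ∫ x in unitCell n, classicalPartial i φ x = 0 := by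
  cases n with
  | zero => exact i.elim0
  | succ m =>
    have hIcc : cellMeasure (m + 1) = volume.restrict (Set.Icc (0 : Fin (m + 1) → ℝ) 1) :=
      Measure.restrict_congr_set
        (Measure.univ_pi_Ioo_ae_eq_Icc (μ := fun _ : Fin (m + 1) => (volume : Measure ℝ))
          (f := fun _ => (0 : ℝ)) (g := fun _ => 1))
    change ∫ x, classicalPartial i φ x ∂(cellMeasure (m + 1)) = 0
    have hsum : ∀ x, ∑ j, ((if j = i then fderiv ℝ φ x else 0 : (Fin (m + 1) → ℝ) →L[ℝ] ℝ))
        (Pi.single j 1) = classicalPartial i φ x := by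
      intro x
      rw [Finset.sum_eq_single i]
      · simp [classicalPartial]
      · intro j _ hj; simp [hj]
      · simp
    -- The divergence theorem is applied to the field φ eᵢ; by periodicity the fluxes through the
    -- two faces orthogonal to eᵢ cancel.
    have key := integral_divergence_of_hasFDerivAt_off_countable' (0 : Fin (m + 1) → ℝ) 1
      zero_le_one (fun j x => if j = i then φ x else 0)
      (fun j x => if j = i then fderiv ℝ φ x else 0) ∅ Set.countable_empty
      (fun j => by
        by_cases h : j = i
        · simpa [h] using hφ.continuous.continuousOn
        · simpa [h] using continuousOn_const)
      (fun x _ j => by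
        by_cases h : j = i
        · simpa [h] using (hφ.differentiable (by simp) x).hasFDerivAt
        · simpa [h] using hasFDerivAt_const (0 : ℝ) x)
      (by
        simp only [hsum]
        exact (continuous_classicalPartial hφ i).continuousOn.integrableOn_compact isCompact_Icc)
    simp only [hsum] at key
    rw [hIcc, key]
    refine Finset.sum_eq_zero fun j _ => ?_
    by_cases h : j = i
    · simp only [h, if_true]
      rw [sub_eq_zero]
      congr 1 with x
      have := hper (i.insertNth (0 : ℝ) x) (Pi.single i 1)
      simp only [Pi.one_apply, Pi.zero_apply]
      rw [← this]
      congr 1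
      funext l
      refine Fin.succAboveCases i ?_ (fun l => ?_) l
      · simp
      · simp
    · simp [h]

lemma classicalPartial_mul {φ ψ : (Fin n → ℝ) → ℝ} (hφ : ContDiff ℝ ∞ φ) (hψ : ContDiff ℝ ∞ ψ)
    (i : Fin n) (x : Fin n → ℝ) : classicalPartial i (fun y => φ y * ψ y) x =
      φ x * classicalPartial i ψ x + classicalPartial i φ x * ψ x := by
  unfold classicalPartial
  rw [fderiv_fun_mul (hφ.differentiable (by simp) x) (hψ.differentiable (by simp) x)]
  simp [mul_comm]

/-- Classical derivatives of smooth periodic functions are weak derivatives. -/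
lemma hasWeakPartial_classicalPartial {φ : (Fin n → ℝ) → ℝ} (hφ : ContDiff ℝ ∞ φ)
    (hper : YPeriodic φ) (i : Fin n) : HasWeakPartial i φ (classicalPartial i φ) := by
  intro ψ hψ hψper
  have h := integral_classicalPartial_eq_zero (hφ.mul hψ)
    (fun x k => by simp only [hper x k, hψper x k]) i
  have e : classicalPartial i (φ * ψ) = fun x =>
      φ x * classicalPartial i ψ x + classicalPartial i φ x * ψ x :=
    funext fun x => classicalPartial_mul hφ hψ i x
  rw [show (fun x => φ x * ψ x) = φ * ψ from rfl] at h
  rw [e, integral_add] at h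
  · linarith
  · exact (memLp_of_continuous (hφ.continuous.mul (continuous_classicalPartial hψ i)) 1).integrable le_rfl
  · exact (memLp_of_continuous ((continuous_classicalPartial hφ i).mul hψ.continuous) 1).integrable le_rfl

lemma HasWeakPartial.congr {i : Fin n} {u u' g g' : (Fin n → ℝ) → ℝ} (h : HasWeakPartial i u g)
    (hu : u =ᵐ[cellMeasure n] u') (hg : g =ᵐ[cellMeasure n] g') : HasWeakPartial i u' g' := by
  intro φ hφ hper
  have h1 : ∫ x in unitCell n, u' x * classicalPartial i φ x =
      ∫ x in unitCell n, u x * classicalPartial i φ x :=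
    integral_congr_ae (hu.symm.mul (Filter.EventuallyEq.refl _ _))
  have h2 : ∫ x in unitCell n, g' x * φ x = ∫ x in unitCell n, g x * φ x :=
    integral_congr_ae (hg.symm.mul (Filter.EventuallyEq.refl _ _))
  rw [h1, h2, h φ hφ hper]

/-! ### Weak derivatives as Fourier multipliers. -/

/-- The Fourier symbol of the partial derivative `∂_i`. -/
def partialSymbol (i : Fin n) (k : Fin n → ℤ) : ℂ := 2 * Real.pi * Complex.I * (k i : ℂ)

lemma hasFDerivAt_character (k : Fin n → ℤ) (x : Fin n → ℝ) :
    HasFDerivAt (character k) (∑ j, (partialSymbol j k * character k x) •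
      (Complex.ofRealCLM.comp (ContinuousLinearMap.proj (R := ℝ) (φ := fun _ : Fin n => ℝ) j))) x := by
  have h : HasFDerivAt (fun y : Fin n → ℝ => ∑ j, partialSymbol j k * (y j : ℂ))
      (∑ j, partialSymbol j k • (Complex.ofRealCLM.comp
        (ContinuousLinearMap.proj (R := ℝ) (φ := fun _ : Fin n => ℝ) j))) x := by
    refine HasFDerivAt.fun_sum fun j _ => ?_
    exact (Complex.ofRealCLM.comp
      (ContinuousLinearMap.proj (R := ℝ) (φ := fun _ : Fin n => ℝ) j)).hasFDerivAt.const_mul _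
  have e : character k = fun y => Complex.exp (∑ j, partialSymbol j k * (y j : ℂ)) := by
    funext y
    simp only [character, partialSymbol, Finset.mul_sum, mul_assoc]
  have := h.cexp
  rw [e]
  refine this.congr_fderiv ?_
  rw [Finset.smul_sum]
  refine Finset.sum_congr rfl fun j _ => ?_
  rw [smul_smul, mul_comm]

lemma fderiv_character (k : Fin n → ℤ) (i : Fin n) (x : Fin n → ℝ) :
    fderiv ℝ (character k) x (Pi.single i 1) = partialSymbol i k * character k x := by
  rw [(hasFDerivAt_character k x).fderiv]
  simp only [_root_.sum_apply, _root_.smul_apply]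
  rw [Finset.sum_eq_single i]
  · simp
  · intro j _ hj; simp [hj]
  · simp

lemma contDiff_character (k : Fin n → ℤ) : ContDiff ℝ ∞ (character k) := by
  unfold character
  refine ContDiff.cexp (contDiff_const.mul (ContDiff.sum fun j _ => contDiff_const.mul ?_))
  exact Complex.ofRealCLM.contDiff.comp (contDiff_apply ℝ ℝ j)

lemma character_periodic (k : Fin n → ℤ) : YPeriodic (character k) := by
  intro x m
  have : (2 * Real.pi * Complex.I * ∑ j, (k j : ℂ) * ((x j + (m j : ℝ) : ℝ) : ℂ)) =
      2 * Real.pi * Complex.I * ∑ j, (k j : ℂ) * (x j : ℂ) +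
        ((∑ j, k j * m j : ℤ) : ℂ) * (2 * Real.pi * Complex.I) := by
    push_cast
    simp only [mul_add, Finset.sum_add_distrib]
    ring
  simp only [character, Pi.add_apply]
  rw [this, Complex.exp_add, Complex.exp_int_mul_two_pi_mul_I, mul_one]

/-- Complex valued test functions may be used for weak derivatives. -/
lemma HasWeakPartial.integral_complex {i : Fin n} {u g : Lp ℝ 2 (cellMeasure n)}
    (h : HasWeakPartial i u g) {Ψ : (Fin n → ℝ) → ℂ} (hΨ : ContDiff ℝ ∞ Ψ) (hper : YPeriodic Ψ) :
    ∫ x, (u x : ℂ) * fderiv ℝ Ψ x (Pi.single i 1) ∂(cellMeasure n) =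
      - ∫ x, (g x : ℂ) * Ψ x ∂(cellMeasure n) := by
  have hint : ∀ (f : Lp ℝ 2 (cellMeasure n)) (Φ : (Fin n → ℝ) → ℂ), Continuous Φ →
      Integrable (fun x => (f x : ℂ) * Φ x) (cellMeasure n) := by
    intro f Φ hΦ
    have h1 : MemLp (fun x => (f x : ℂ)) 2 (cellMeasure n) := (Lp.memLp f).ofReal
    exact h1.integrable_mul (memLp_of_continuous hΦ 2)
  have hc : Continuous fun x => fderiv ℝ Ψ x (Pi.single i 1) :=
    (hΨ.continuous_fderiv (by simp)).clm_apply continuous_const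
  -- L stands for the real or the imaginary part, so that L ∘ Ψ is an admissible real test function.
  have key : ∀ L : ℂ →L[ℝ] ℝ, (∀ (r : ℝ) z, L (r * z) = r * L z) →
      L (∫ x, (u x : ℂ) * fderiv ℝ Ψ x (Pi.single i 1) ∂(cellMeasure n)) =
      L (- ∫ x, (g x : ℂ) * Ψ x ∂(cellMeasure n)) := by
    intro L hL
    have ht := h (fun x => L (Ψ x)) (L.contDiff.comp hΨ) (fun x k => by simp only [hper x k])
    rw [map_neg, ← L.integral_comp_comm (hint u _ hc), ← L.integral_comp_comm (hint g _ hΨ.continuous)]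
    simp only [hL]
    rw [← ht]
    congr 1 with x
    congr 1
    unfold classicalPartial
    have : HasFDerivAt (fun x => L (Ψ x)) (L.comp (fderiv ℝ Ψ x)) x :=
      L.hasFDerivAt.comp x (hΨ.differentiable (by simp) x).hasFDerivAt
    rw [this.fderiv]
    rfl
  refine Complex.ext (key Complex.reCLM ?_) (key Complex.imCLM ?_)
  · intro r z; simp
  · intro r z; simp

lemma HasWeakPartial.fourierCf_eq {i : Fin n} {u g : Lp ℝ 2 (cellMeasure n)}
    (h : HasWeakPartial i u g) (k : Fin n → ℤ) :
    fourierCf k g = partialSymbol i k * fourierCf k u := by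
  have := h.integral_complex (contDiff_character (-k)) (character_periodic (-k))
  simp only [fderiv_character] at this
  rw [fourierCf_eq_integral, fourierCf_eq_integral, ← integral_const_mul]
  simp only [conj_character]
  rw [← neg_eq_iff_eq_neg] at this
  rw [← this, ← integral_neg]
  congr 1 with x
  simp only [partialSymbol, Pi.neg_apply, Int.cast_neg]
  ring

/-- Testing with characters gives one direction. Conversely, a test function obeys the same
multiplier rule, being its own smooth representative; Parseval and the fact that the symbol is
purely imaginary then give integration by parts with its sign. -/
lemma hasWeakPartial_iff {i : Fin n} {u g : Lp ℝ 2 (cellMeasure n)} :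
    HasWeakPartial i u g ↔ ∀ k, fourierCf k g = partialSymbol i k * fourierCf k u := by
  refine ⟨fun h k => h.fourierCf_eq k, fun h φ hφ hper => ?_⟩
  have hp := memLp_of_continuous hφ.continuous 2
  have hq := memLp_of_continuous (continuous_classicalPartial hφ i) 2
  have hw : HasWeakPartial i (hp.toLp φ) (hq.toLp _) :=
    (hasWeakPartial_classicalPartial hφ hper i).congr hp.coeFn_toLp.symm hq.coeFn_toLp.symm
  have e : ∀ (f : Lp ℝ 2 (cellMeasure n)) {ψ : (Fin n → ℝ) → ℝ} (hψ : MemLp ψ 2 (cellMeasure n)),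
      ∫ x in unitCell n, f x * ψ x = ⟪f, hψ.toLp ψ⟫_ℝ := by
    intro f ψ hψ
    rw [L2.inner_def]
    refine integral_congr_ae ?_
    filter_upwards [hψ.coeFn_toLp] with x hx
    simp [hx, mul_comm]
  rw [e u hq, e g hp, ← Complex.ofReal_inj]
  refine (hasSum_fourierCf_mul u (hq.toLp _)).unique ?_
  have := (hasSum_fourierCf_mul g (hp.toLp _)).neg
  push_cast
  refine Eq.mpr ?_ this
  congr 1
  funext k
  rw [h k, hw.fourierCf_eq k, map_mul]
  have : conj (partialSymbol i k) = - partialSymbol i k := by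
    have hk : conj (k i : ℂ) = k i := map_intCast _ _
    simp only [partialSymbol, map_mul, map_ofNat, Complex.conj_ofReal, Complex.conj_I, hk]
    ring
  rw [this]
  ring

/-- `g = ∂_i u` in `L²(Y)`, expressed through Fourier coefficients. -/
def IsPartial (i : Fin n) (u g : Lp ℝ 2 (cellMeasure n)) : Prop :=
  ∀ k, fourierCf k g = partialSymbol i k * fourierCf k u

lemma norm_partialSymbol (i : Fin n) (k : Fin n → ℤ) :
    ‖partialSymbol i k‖ = 2 * Real.pi * |(k i : ℝ)| := by
  simp [partialSymbol, abs_of_pos Real.pi_pos]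

lemma conj_partialSymbol (i : Fin n) (k : Fin n → ℤ) :
    conj (partialSymbol i k) = - partialSymbol i k := by
  have hk : conj (k i : ℂ) = k i := map_intCast _ _
  simp only [partialSymbol, map_mul, map_ofNat, Complex.conj_ofReal, Complex.conj_I, hk]
  ring

lemma partialSymbol_neg (i : Fin n) (k : Fin n → ℤ) :
    partialSymbol i (-k) = - partialSymbol i k := by
  simp [partialSymbol]

lemma partialSymbol_mul_self (i : Fin n) (k : Fin n → ℤ) :
    partialSymbol i k * partialSymbol i k = - ((‖partialSymbol i k‖ ^ 2 : ℝ) : ℂ) := by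
  have h := Complex.mul_conj' (partialSymbol i k)
  rw [conj_partialSymbol] at h
  push_cast
  rw [← h]
  ring

/-- The frequency is an integer, so the symbol either vanishes or has modulus at least 2π. This
bounds the first-order multiplier in the Poisson problem. -/
lemma norm_partialSymbol_le_sq (i : Fin n) (k : Fin n → ℤ) :
    ‖partialSymbol i k‖ ≤ ‖partialSymbol i k‖ ^ 2 := by
  rcases eq_or_ne (k i) 0 with h | h
  · simp [norm_partialSymbol, h]
  · have h1 : (1 : ℝ) ≤ |(k i : ℝ)| := by exact_mod_cast Int.one_le_abs h
    have h2 : 1 ≤ ‖partialSymbol i k‖ := by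
      rw [norm_partialSymbol]
      nlinarith [Real.pi_gt_three]
    nlinarith

lemma four_pi_sq_le_sum_norm_partialSymbol_sq {k : Fin n → ℤ} (hk : k ≠ 0) :
    4 * Real.pi ^ 2 ≤ ∑ j, ‖partialSymbol j k‖ ^ 2 := by
  obtain ⟨i, hi⟩ := Function.ne_iff.mp hk
  have h1 : (1 : ℝ) ≤ |(k i : ℝ)| := by exact_mod_cast Int.one_le_abs hi
  refine le_trans ?_ (Finset.single_le_sum (f := fun j => ‖partialSymbol j k‖ ^ 2)
    (fun j _ => sq_nonneg _) (Finset.mem_univ i))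
  simp only [norm_partialSymbol, mul_pow, sq_abs]
  have : (1 : ℝ) ≤ (k i : ℝ) ^ 2 := by rw [← sq_abs]; nlinarith
  nlinarith [sq_nonneg Real.pi]

/-! ### Commuting derivatives, the Poincaré inequality and the Poisson equation. -/

lemma IsPartial.unique {i : Fin n} {u g g' : Lp ℝ 2 (cellMeasure n)} (h : IsPartial i u g)
    (h' : IsPartial i u g') : g = g' :=
  fourierCf_injective fun k => (h k).trans (h' k).symm

lemma IsPartial.comm {i j : Fin n} {u p q r s : Lp ℝ 2 (cellMeasure n)} (hp : IsPartial i u p)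
    (hq : IsPartial j p q) (hr : IsPartial j u r) (hs : IsPartial i r s) : q = s :=
  fourierCf_injective fun k => by rw [hq k, hp k, hs k, hr k]; ring

/-- Two integrations by parts without second derivatives: both symbols are imaginary and commute, so
the two Parseval series agree term by term. -/
lemma IsPartial.inner_swap {i j : Fin n} {a b p q r s : Lp ℝ 2 (cellMeasure n)}
    (hp : IsPartial i a p) (hq : IsPartial j a q) (hr : IsPartial i b r) (hs : IsPartial j b s) :
    ⟪q, r⟫_ℝ = ⟪p, s⟫_ℝ := by
  rw [← Complex.ofReal_inj]
  refine (hasSum_fourierCf_mul q r).unique ?_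
  refine Eq.mpr ?_ (hasSum_fourierCf_mul p s)
  congr 1
  funext k
  rw [hp k, hq k, hr k, hs k, map_mul, map_mul, conj_partialSymbol, conj_partialSymbol]
  ring

lemma fourierCf_zero (u : Lp ℝ 2 (cellMeasure n)) :
    fourierCf 0 u = ((∫ x, u x ∂(cellMeasure n) : ℝ) : ℂ) := by
  rw [fourierCf_eq_integral, ← integral_complex_ofReal]
  congr 1 with x
  simp [character]

lemma IsPartial.integral_eq_zero {i : Fin n} {u g : Lp ℝ 2 (cellMeasure n)}
    (h : IsPartial i u g) : ∫ x, g x ∂(cellMeasure n) = 0 := by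
  have := h 0
  rw [fourierCf_zero] at this
  simpa [partialSymbol] using this

/-- The Poincaré inequality for periodic functions of mean zero. -/
lemma poincare_inequality {u : Lp ℝ 2 (cellMeasure n)} {g : Fin n → Lp ℝ 2 (cellMeasure n)}
    (hu : ∫ x, u x ∂(cellMeasure n) = 0) (hg : ∀ j, IsPartial j u (g j)) :
    4 * Real.pi ^ 2 * ‖u‖ ^ 2 ≤ ∑ j, ‖g j‖ ^ 2 := by
  refine hasSum_le (fun k => ?_) ((hasSum_norm_fourierCf_sq u).mul_left _)
    (hasSum_sum fun j _ => hasSum_norm_fourierCf_sq (g j))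
  simp only [hg _ k, norm_mul, mul_pow, ← Finset.sum_mul]
  rcases eq_or_ne k 0 with rfl | hk
  · simp [fourierCf_zero, hu]
  · exact mul_le_mul_of_nonneg_right (four_pi_sq_le_sum_norm_partialSymbol_sq hk) (sq_nonneg _)

/-- Bounded Hermitian Fourier multipliers act on `L²(Y)`. -/
lemma exists_fourier_multiplier {m : (Fin n → ℤ) → ℂ} {C : ℝ} (hm : ∀ k, ‖m k‖ ≤ C)
    (hsymm : ∀ k, m (-k) = conj (m k)) (u : Lp ℝ 2 (cellMeasure n)) :
    ∃ v : Lp ℝ 2 (cellMeasure n), ∀ k, fourierCf k v = m k * fourierCf k u := by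
  refine exists_fourierCf_eq ?_ fun k => by rw [hsymm, fourierCf_neg, map_mul]
  refine memℓp_gen ?_
  refine Summable.of_nonneg_of_le (fun k => by positivity) (fun k => ?_)
    ((hasSum_norm_fourierCf_sq u).summable.mul_left (C ^ 2))
  have h2 : (2 : ENNReal).toReal = ((2 : ℕ) : ℝ) := by norm_num
  rw [h2, Real.rpow_natCast, norm_mul, mul_pow]
  gcongr
  exact hm k

/-- Solvability of the Poisson equation `Δψ = u` in `H²_per(Y)`. -/
lemma exists_poisson {u : Lp ℝ 2 (cellMeasure n)} (hu : ∫ x, u x ∂(cellMeasure n) = 0) :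
    ∃ (ψ : Lp ℝ 2 (cellMeasure n)) (w : Fin n → Lp ℝ 2 (cellMeasure n))
      (h : Fin n → Fin n → Lp ℝ 2 (cellMeasure n)),
      (∀ i, IsPartial i ψ (w i)) ∧ (∀ i j, IsPartial j (w i) (h i j)) ∧ ∑ i, h i i = u := by
  set N : (Fin n → ℤ) → ℝ := fun k => ∑ j, ‖partialSymbol j k‖ ^ 2 with hN
  have hN0 : ∀ k, 0 ≤ N k := fun k => Finset.sum_nonneg fun _ _ => sq_nonneg _
  have hNneg : ∀ k, N (-k) = N k := fun k => by simp [hN, partialSymbol_neg]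
  have hNj : ∀ j k, ‖partialSymbol j k‖ ^ 2 ≤ N k := fun j k =>
    Finset.single_le_sum (f := fun j => ‖partialSymbol j k‖ ^ 2)
      (fun j _ => sq_nonneg _) (Finset.mem_univ j)
  have hN1 : ∀ k, ‖-(1 / (N k : ℂ))‖ = 1 / N k := fun k => by
    rw [norm_neg, norm_div, norm_one, Complex.norm_real, Real.norm_of_nonneg (hN0 k)]
  have hdiv : ∀ k (a : ℝ), a ≤ N k → a * (1 / N k) ≤ 1 := fun k a ha => by
    rw [mul_one_div]
    exact div_le_one_of_le₀ ha (hN0 k)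
  -- Inverse of the Laplacian symbol -N. At k = 0 the convention 1/0 = 0 removes the zero mode,
  -- which is harmless because u has mean zero.
  obtain ⟨ψ, hψ⟩ := exists_fourier_multiplier (m := fun k => -(1 / (N k : ℂ))) (C := 1)
    (fun k => by
      rw [hN1]
      rcases eq_or_ne k 0 with rfl | hk
      · simp [hN, norm_partialSymbol]
      · have := four_pi_sq_le_sum_norm_partialSymbol_sq hk
        rw [← one_mul (1 / N k)]
        exact hdiv k 1 (le_trans (by nlinarith [Real.pi_gt_three]) this))
    (fun k => by simp [hNneg]) u
  choose w hw using fun i => exists_fourier_multiplier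
    (m := fun k => partialSymbol i k * -(1 / (N k : ℂ))) (C := 1)
    (fun k => by
      rw [norm_mul, hN1]
      exact hdiv k _ ((norm_partialSymbol_le_sq i k).trans (hNj i k)))
    (fun k => by
      rw [map_mul, conj_partialSymbol, partialSymbol_neg, hNneg]
      simp) u
  choose h hh using fun i j => exists_fourier_multiplier
    (m := fun k => partialSymbol j k * partialSymbol i k * -(1 / (N k : ℂ))) (C := 1)
    (fun k => by
      rw [norm_mul, norm_mul, hN1]
      refine hdiv k _ ?_
      -- 2|σᵢ||σⱼ| ≤ |σᵢ|² + |σⱼ|² ≤ 2N, where σ denotes the symbols.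
      nlinarith [hNj i k, hNj j k, sq_nonneg (‖partialSymbol i k‖ - ‖partialSymbol j k‖)])
    (fun k => by
      rw [map_mul, map_mul, conj_partialSymbol, conj_partialSymbol, partialSymbol_neg,
        partialSymbol_neg, hNneg]
      simp) u
  refine ⟨ψ, w, h, fun i k => ?_, fun i j k => ?_, fourierCf_injective fun k => ?_⟩
  · rw [hw, hψ]; ring
  · rw [hh, hw]; ring
  · rw [map_sum]
    simp only [hh, partialSymbol_mul_self, ← Finset.sum_mul, Finset.sum_neg_distrib,
      ← Complex.ofReal_sum]
    rcases eq_or_ne k 0 with rfl | hk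
    · simp [fourierCf_zero, hu]
    · have h0 : (N k : ℂ) ≠ 0 := by
        have := four_pi_sq_le_sum_norm_partialSymbol_sq hk
        have : 0 < N k := lt_of_lt_of_le (by positivity) this
        exact_mod_cast this.ne'
      change -(N k : ℂ) * -(1 / (N k : ℂ)) * _ = _
      field_simp

/-! ### Passage between periodic functions and classes on the cell. -/

/-- Two periodic functions that agree almost everywhere on the cell agree almost everywhere. -/
lemma YPeriodic.ae_eq {α : Type*} {f g : (Fin n → ℝ) → α} (hf : YPeriodic f) (hg : YPeriodic g)
    (h : f =ᵐ[cellMeasure n] g) : f =ᵐ[volume] g := by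
  have h0 : ∀ᵐ x : Fin n → ℝ, x ∈ unitCell n → f x = g x :=
    (ae_restrict_iff' (measurableSet_unitCell n)).mp h
  have h1 : ∀ᵐ x : Fin n → ℝ, ∀ k : Fin n → ℤ,
      (x + fun i => (k i : ℝ)) ∈ unitCell n → f x = g x := by
    rw [ae_all_iff]
    intro k
    have := (measurePreserving_add_right (volume : Measure (Fin n → ℝ))
      (fun i => (k i : ℝ))).quasiMeasurePreserving.ae h0
    filter_upwards [this] with x hx hxk
    rw [← hf x k, ← hg x k]
    exact hx hxk
  have h2 : ∀ᵐ x : Fin n → ℝ, ∀ i, x i ∉ Set.range ((↑) : ℤ → ℝ) := by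
    rw [ae_all_iff]
    intro i
    have hc : ∀ᵐ t : ℝ, t ∉ Set.range ((↑) : ℤ → ℝ) :=
      (Set.countable_range _).ae_notMem volume
    exact (Measure.quasiMeasurePreserving_eval (fun _ : Fin n => (volume : Measure ℝ)) i).ae hc
  filter_upwards [h1, h2] with x hx hx2
  -- Translation by the integer parts moves x into the half-open cube, and into the open cell
  -- because no coordinate is an integer.
  refine hx (fun i => -⌊x i⌋) fun i _ => ?_
  have e : (x + fun i => ((-⌊x i⌋ : ℤ) : ℝ)) i = Int.fract (x i) := by
    simp [Int.fract, sub_eq_add_neg]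
  rw [e]
  refine ⟨lt_of_le_of_ne (Int.fract_nonneg _) fun h => hx2 i ?_, Int.fract_lt_one _⟩
  exact ⟨⌊x i⌋, by have := Int.floor_add_fract (x i); rw [← h, add_zero] at this; exact this⟩

/-- The periodic extension of the restriction of a function to the cell. -/
def perExt (f : (Fin n → ℝ) → ℝ) (x : Fin n → ℝ) : ℝ := f fun i => Int.fract (x i)

lemma yPeriodic_perExt (f : (Fin n → ℝ) → ℝ) : YPeriodic (perExt f) := by
  intro x k
  simp [perExt]

lemma perExt_ae_eq (f : (Fin n → ℝ) → ℝ) : perExt f =ᵐ[cellMeasure n] f := by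
  filter_upwards [ae_mem_unitCell n] with x hx
  unfold perExt
  congr 1
  funext i
  have := hx i trivial
  exact Int.fract_eq_self.mpr ⟨this.1.le, this.2⟩

lemma memLpPer_perExt (f : Lp ℝ 2 (cellMeasure n)) : MemLpPer 2 (perExt f) :=
  ⟨yPeriodic_perExt _, (Lp.memLp f).ae_eq (perExt_ae_eq f).symm⟩

open Classical in
/-- The class in `L²(Y)` of a square integrable function, and zero for other functions. -/
def cellLp (u : (Fin n → ℝ) → ℝ) : Lp ℝ 2 (cellMeasure n) :=
  if h : MemLp u 2 (cellMeasure n) then h.toLp u else 0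

lemma coeFn_cellLp {u : (Fin n → ℝ) → ℝ} (h : MemLp u 2 (cellMeasure n)) :
    cellLp u =ᵐ[cellMeasure n] u := by
  rw [cellLp, dif_pos h]
  exact h.coeFn_toLp

lemma cellLp_eq {u : (Fin n → ℝ) → ℝ} {f : Lp ℝ 2 (cellMeasure n)}
    (h : f =ᵐ[cellMeasure n] u) : cellLp u = f :=
  Lp.ext ((coeFn_cellLp ((Lp.memLp f).ae_eq h)).trans h.symm)

@[simp] lemma cellLp_perExt (f : Lp ℝ 2 (cellMeasure n)) : cellLp (perExt f) = f :=
  cellLp_eq (perExt_ae_eq f).symm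

lemma integral_cellLp {u : (Fin n → ℝ) → ℝ} (h : MemLp u 2 (cellMeasure n)) :
    ∫ x, cellLp u x ∂(cellMeasure n) = ∫ x in unitCell n, u x :=
  integral_congr_ae (coeFn_cellLp h)

lemma inner_cellLp {u v : (Fin n → ℝ) → ℝ} (hu : MemLp u 2 (cellMeasure n))
    (hv : MemLp v 2 (cellMeasure n)) :
    ⟪cellLp u, cellLp v⟫_ℝ = ∫ x in unitCell n, u x * v x := by
  rw [L2.inner_def]
  refine integral_congr_ae ?_
  filter_upwards [coeFn_cellLp hu, coeFn_cellLp hv] with x h1 h2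
  simp [h1, h2, mul_comm]

lemma HasL2WeakPartial.weakPartial_spec {i : Fin n} {u : (Fin n → ℝ) → ℝ}
    (h : HasL2WeakPartial i u) :
    MemLpPer 2 (weakPartial i u) ∧ HasWeakPartial i u (weakPartial i u) := by
  rw [weakPartial, dif_pos h]
  exact h.choose_spec

lemma memLpPer_weakPartial (i : Fin n) (u : (Fin n → ℝ) → ℝ) : MemLpPer 2 (weakPartial i u) := by
  by_cases h : HasL2WeakPartial i u
  · exact h.weakPartial_spec.1
  · rw [weakPartial, dif_neg h]
    exact ⟨fun _ _ => rfl, MemLp.zero⟩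

lemma HasL2WeakPartial.isPartial {i : Fin n} {u : (Fin n → ℝ) → ℝ}
    (hu : MemLp u 2 (cellMeasure n)) (h : HasL2WeakPartial i u) :
    IsPartial i (cellLp u) (cellLp (weakPartial i u)) :=
  hasWeakPartial_iff.mp (h.weakPartial_spec.2.congr (coeFn_cellLp hu).symm
    (coeFn_cellLp h.weakPartial_spec.1.2).symm)

lemma IsPartial.hasL2WeakPartial {i : Fin n} {u : (Fin n → ℝ) → ℝ} {g : Lp ℝ 2 (cellMeasure n)}
    (hu : MemLp u 2 (cellMeasure n)) (h : IsPartial i (cellLp u) g) : HasL2WeakPartial i u :=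
  ⟨perExt g, memLpPer_perExt g,
    (hasWeakPartial_iff.mpr h).congr (coeFn_cellLp hu) (perExt_ae_eq g).symm⟩

lemma IsPartial.cellLp_weakPartial {i : Fin n} {u : (Fin n → ℝ) → ℝ}
    {g : Lp ℝ 2 (cellMeasure n)} (hu : MemLp u 2 (cellMeasure n))
    (h : IsPartial i (cellLp u) g) : cellLp (weakPartial i u) = g :=
  ((h.hasL2WeakPartial hu).isPartial hu).unique h

lemma MemH1Per.isPartial {u : (Fin n → ℝ) → ℝ} (h : MemH1Per u) (i : Fin n) :
    IsPartial i (cellLp u) (cellLp (weakPartial i u)) :=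
  (h.2 i).isPartial h.1.2

lemma memH1Per_of_isPartial {u : (Fin n → ℝ) → ℝ} {g : Fin n → Lp ℝ 2 (cellMeasure n)}
    (hu : MemLpPer 2 u) (h : ∀ i, IsPartial i (cellLp u) (g i)) : MemH1Per u :=
  ⟨hu, fun i => (h i).hasL2WeakPartial hu.2⟩

/-! ### Jets and the operators acting on them. -/

/-- Indices of the components of a vector field and of its Jacobian. -/
abbrev JetIndex (n : ℕ) : Type := Fin n ⊕ Fin n × Fin n

/-- First order jets: a square integrable vector field together with a candidate Jacobian. -/
abbrev Jet (n : ℕ) : Type := PiLp 2 fun _ : JetIndex n => Lp ℝ 2 (cellMeasure n)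

/-- The space `H¹_{per,0}(Y; ℝⁿ)` as a closed subspace of the space of jets. -/
def sobolevJets (n : ℕ) : Submodule ℝ (Jet n) where
  carrier := {x | (∀ i j, IsPartial j (x (.inl i)) (x (.inr (i, j)))) ∧
    ∀ i, fourierCf 0 (x (.inl i)) = 0}
  add_mem' := fun {x y} hx hy => ⟨fun i j k => by
      simp only [PiLp.add_apply, map_add, hx.1 i j k, hy.1 i j k, mul_add],
    fun i => by simp only [PiLp.add_apply, map_add, hx.2 i, hy.2 i, add_zero]⟩
  zero_mem' := ⟨fun i j k => by simp, fun i => by simp⟩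
  smul_mem' := fun c x hx => ⟨fun i j k => by
      simp only [PiLp.smul_apply, map_smul, hx.1 i j k, mul_smul_comm],
    fun i => by simp only [PiLp.smul_apply, map_smul, hx.2 i, smul_zero]⟩

/-- Each defining condition equates continuous functions of the jet, as Fourier coefficients are
continuous functionals. Closedness supplies the completeness needed for Lax–Milgram. -/
lemma isClosed_sobolevJets (n : ℕ) : IsClosed (sobolevJets n : Set (Jet n)) := by
  have hc : ∀ (k : Fin n → ℤ) (s : JetIndex n),
      Continuous fun x : Jet n => fourierCf k (x s) := fun k s =>
    (fourierCf k).continuous.comp (PiLp.continuous_apply 2 _ s)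
  have : (sobolevJets n : Set (Jet n)) =
      {x | (∀ i j k, fourierCf k (x (.inr (i, j))) = partialSymbol j k * fourierCf k (x (.inl i))) ∧
        ∀ i, fourierCf 0 (x (.inl i)) = 0} := rfl
  rw [this]
  simp only [Set.ofPred_and, Set.ofPred_forall]
  refine IsClosed.inter ?_ ?_
  · exact isClosed_iInter fun i => isClosed_iInter fun j => isClosed_iInter fun k =>
      isClosed_eq (hc _ _) (continuous_const.mul (hc _ _))
  · exact isClosed_iInter fun i => isClosed_eq (hc _ _) continuous_const

instance (n : ℕ) : CompleteSpace (sobolevJets n) :=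
  (isClosed_sobolevJets n).completeSpace_coe

/-- Multiplication by a bounded function on `L²(Y)`. -/
def mulCLM (a : (Fin n → ℝ) → ℝ) (ha : MemLp a ⊤ (cellMeasure n)) :
    Lp ℝ 2 (cellMeasure n) →L[ℝ] Lp ℝ 2 (cellMeasure n) :=
  (ContinuousLinearMap.mul ℝ ℝ).holderL (cellMeasure n) ⊤ 2 2 (ha.toLp a)

lemma coeFn_mulCLM {a : (Fin n → ℝ) → ℝ} (ha : MemLp a ⊤ (cellMeasure n))
    (f : Lp ℝ 2 (cellMeasure n)) : mulCLM a ha f =ᵐ[cellMeasure n] fun x => a x * f x := by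
  refine ((ContinuousLinearMap.mul ℝ ℝ).coeFn_holder (r := 2) (ha.toLp a) f).trans ?_
  filter_upwards [ha.coeFn_toLp] with x hx
  simp [hx]

/-- The operator `x ↦ ∑ c_s x_s` on jets. -/
def jetOp (c : JetIndex n → (Fin n → ℝ) → ℝ) (hc : ∀ s, MemLp (c s) ⊤ (cellMeasure n)) :
    Jet n →L[ℝ] Lp ℝ 2 (cellMeasure n) :=
  ∑ s, (mulCLM (c s) (hc s)).comp (PiLp.proj 2 _ s)

lemma coeFn_sum {ι : Type*} (t : Finset ι) (f : ι → Lp ℝ 2 (cellMeasure n)) :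
    (∑ s ∈ t, f s : Lp ℝ 2 (cellMeasure n)) =ᵐ[cellMeasure n] fun y => ∑ s ∈ t, f s y := by
  classical
  induction t using Finset.induction_on with
  | empty => simpa only [Finset.sum_empty] using! Lp.coeFn_zero ℝ 2 (cellMeasure n)
  | insert a t ha ih =>
    rw [Finset.sum_insert ha]
    filter_upwards [Lp.coeFn_add (f a) (∑ s ∈ t, f s), ih] with y h1 h2
    rw [h1, Pi.add_apply, h2, Finset.sum_insert ha]

lemma coeFn_jetOp {c : JetIndex n → (Fin n → ℝ) → ℝ} (hc : ∀ s, MemLp (c s) ⊤ (cellMeasure n))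
    (x : Jet n) : jetOp c hc x =ᵐ[cellMeasure n] fun y => ∑ s, c s y * x s y := by
  have h : jetOp c hc x = ∑ s, mulCLM (c s) (hc s) (x s) := by
    simp [jetOp, _root_.sum_apply]
  rw [h]
  filter_upwards [coeFn_sum Finset.univ fun s => mulCLM (c s) (hc s) (x s),
    ae_all_iff.mpr fun s => coeFn_mulCLM (hc s) (x s)] with y h1 h2
  rw [h1]
  exact Finset.sum_congr rfl fun s _ => h2 s

/-- The divergence of a jet. -/
def jetDiv (n : ℕ) : Jet n →L[ℝ] Lp ℝ 2 (cellMeasure n) :=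
  ∑ i, PiLp.proj 2 _ (.inr (i, i))

lemma jetDiv_apply (x : Jet n) : jetDiv n x = ∑ i, x (.inr (i, i)) := by
  simp [jetDiv, _root_.sum_apply]

/-- The component `∂_j w_i - ∂_i w_j` of the skew part of the Jacobian of a jet. -/
def jetSkew (i j : Fin n) : Jet n →L[ℝ] Lp ℝ 2 (cellMeasure n) :=
  PiLp.proj 2 _ (.inr (i, j)) - PiLp.proj 2 _ (.inr (j, i))

lemma jetSkew_apply (i j : Fin n) (x : Jet n) :
    jetSkew i j x = x (.inr (i, j)) - x (.inr (j, i)) := by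
  simp [jetSkew]

/-- The values of the coefficients of the divergence operator. -/
def divCoeff (n : ℕ) : JetIndex n → ℝ := Sum.elim 0 fun p => if p.1 = p.2 then 1 else 0

lemma norm_sq_eq_integral (f : Lp ℝ 2 (cellMeasure n)) :
    ‖f‖ ^ 2 = ∫ y, f y ^ 2 ∂(cellMeasure n) := by
  rw [← real_inner_self_eq_norm_sq, L2.inner_def]
  congr 1 with y
  simp [sq]

lemma integrable_sq (f : Lp ℝ 2 (cellMeasure n)) :
    Integrable (fun y => f y ^ 2) (cellMeasure n) :=
  (Lp.memLp f).integrable_sq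

lemma jet_norm_sq (x : Jet n) : ‖x‖ ^ 2 =
    ∑ i, ‖x (.inl i)‖ ^ 2 + ∑ i, ∑ j, ‖x (.inr (i, j))‖ ^ 2 := by
  rw [PiLp.norm_sq_eq_of_L2, Fintype.sum_sum_type, Fintype.sum_prod_type]

/-- The distance between `x ↦ ∑ c_s x_s` and the divergence. -/
lemma norm_jetOp_sub_jetDiv_sq_le {c : JetIndex n → (Fin n → ℝ) → ℝ}
    (hc : ∀ s, MemLp (c s) ⊤ (cellMeasure n)) {κ : ℝ}
    (hκ : ∀ᵐ y ∂(cellMeasure n), ∑ s, (c s y - divCoeff n s) ^ 2 ≤ κ) (x : Jet n) :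
    ‖jetOp c hc x - jetDiv n x‖ ^ 2 ≤ κ * ‖x‖ ^ 2 := by
  rw [PiLp.norm_sq_eq_of_L2, norm_sq_eq_integral]
  simp only [norm_sq_eq_integral]
  rw [← integral_finsetSum _ fun s _ => integrable_sq (x s), ← integral_const_mul]
  refine integral_mono_ae (integrable_sq _)
    ((integrable_finsetSum _ fun s _ => integrable_sq (x s)).const_mul κ) ?_
  rw [jetDiv_apply]
  filter_upwards [hκ, coeFn_jetOp hc x, Lp.coeFn_sub (jetOp c hc x) (∑ i, x (.inr (i, i))),
    coeFn_sum Finset.univ fun i => x (.inr (i, i))] with y h1 h2 h3 h4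
  have e : (jetOp c hc x - ∑ i, x (.inr (i, i)) : Lp ℝ 2 (cellMeasure n)) y =
      ∑ s, (c s y - divCoeff n s) * x s y := by
    rw [h3, Pi.sub_apply, h2, h4]
    simp only [sub_mul, Finset.sum_sub_distrib]
    congr 1
    simp [divCoeff, Fintype.sum_sum_type, Fintype.sum_prod_type]
  simp only [e]
  -- Pointwise Cauchy–Schwarz over all n + n² components of the jet.
  exact (Finset.sum_mul_sq_le_sq_mul_sq _ _ _).trans
    (mul_le_mul_of_nonneg_right h1 (Finset.sum_nonneg fun _ _ => sq_nonneg _))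

/-- Expanding the skew part leaves the cross terms ⟨∂ⱼwᵢ, ∂ᵢwⱼ⟩; periodicity turns each of them into
⟨∂ᵢwᵢ, ∂ⱼwⱼ⟩, and these sum to the square of the divergence. -/
lemma sum_norm_jacobian_sq {x : Jet n} (hx : x ∈ sobolevJets n) :
    ∑ i, ∑ j, ‖x (.inr (i, j))‖ ^ 2 =
      ‖jetDiv n x‖ ^ 2 + 1 / 2 * ∑ i, ∑ j, ‖jetSkew i j x‖ ^ 2 := by
  have h1 : ‖jetDiv n x‖ ^ 2 = ∑ i, ∑ j, ⟪x (.inr (i, j)), x (.inr (j, i))⟫_ℝ := by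
    rw [← real_inner_self_eq_norm_sq, jetDiv_apply, sum_inner]
    refine Finset.sum_congr rfl fun i _ => ?_
    rw [inner_sum]
    refine Finset.sum_congr rfl fun j _ => ?_
    exact ((hx.1 i i).inner_swap (hx.1 i j) (hx.1 j i) (hx.1 j j)).symm
  have h2 : ∑ i, ∑ j, ‖jetSkew i j x‖ ^ 2 =
      ∑ i, ∑ j, ‖x (.inr (i, j))‖ ^ 2 + ∑ i, ∑ j, ‖x (.inr (j, i))‖ ^ 2
        - 2 * ∑ i, ∑ j, ⟪x (.inr (i, j)), x (.inr (j, i))⟫_ℝ := by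
    simp only [jetSkew_apply, Finset.mul_sum, ← Finset.sum_add_distrib, ← Finset.sum_sub_distrib]
    refine Finset.sum_congr rfl fun i _ => Finset.sum_congr rfl fun j _ => ?_
    rw [norm_sub_sq_real]
    ring
  have h3 : ∑ i, ∑ j, ‖x (.inr (j, i))‖ ^ 2 = ∑ i, ∑ j, ‖x (.inr (i, j))‖ ^ 2 :=
    Finset.sum_comm
  rw [h1, h2, h3]
  ring

lemma poincare_jet {x : Jet n} (hx : x ∈ sobolevJets n) :
    4 * Real.pi ^ 2 * ∑ i, ‖x (.inl i)‖ ^ 2 ≤ ∑ i, ∑ j, ‖x (.inr (i, j))‖ ^ 2 := by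
  rw [Finset.mul_sum]
  refine Finset.sum_le_sum fun i _ => poincare_inequality ?_ (hx.1 i)
  have := hx.2 i
  rw [fourierCf_zero] at this
  exact_mod_cast this

/-! ### The bilinear form, its coercivity and Lax–Milgram. -/

/-- The inner product of `L²(Y)` as a continuous bilinear form. -/
def innerBilin (n : ℕ) :
    Lp ℝ 2 (cellMeasure n) →L[ℝ] Lp ℝ 2 (cellMeasure n) →L[ℝ] ℝ :=
  (isBoundedBilinearMap_inner (𝕜 := ℝ) (E := Lp ℝ 2 (cellMeasure n))).toContinuousLinearMap

/-- The bilinear form `B₂` on jets. -/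
def jetForm (c : JetIndex n → (Fin n → ℝ) → ℝ) (hc : ∀ s, MemLp (c s) ⊤ (cellMeasure n)) :
    sobolevJets n →L[ℝ] sobolevJets n →L[ℝ] ℝ :=
  (innerBilin n).bilinearComp ((jetDiv n).comp (sobolevJets n).subtypeL)
      ((jetOp c hc).comp (sobolevJets n).subtypeL) +
    (1 / 2 : ℝ) • ∑ i, ∑ j, (innerBilin n).bilinearComp ((jetSkew i j).comp (sobolevJets n).subtypeL)
      ((jetSkew i j).comp (sobolevJets n).subtypeL)

lemma jetForm_apply {c : JetIndex n → (Fin n → ℝ) → ℝ} (hc : ∀ s, MemLp (c s) ⊤ (cellMeasure n))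
    (x y : sobolevJets n) : jetForm c hc x y = ⟪jetDiv n (x : Jet n), jetOp c hc (y : Jet n)⟫_ℝ +
      1 / 2 * ∑ i, ∑ j, ⟪jetSkew i j (x : Jet n), jetSkew i j (y : Jet n)⟫_ℝ := by
  simp [jetForm, innerBilin, _root_.sum_apply]

/-- With the divergence in place of the operator the form on the diagonal would be exactly ‖Dw‖².
The perturbation costs at most θ‖Dw‖², and the Poincaré inequality recovers the full norm. -/
lemma isCoercive_jetForm {c : JetIndex n → (Fin n → ℝ) → ℝ}
    (hc : ∀ s, MemLp (c s) ⊤ (cellMeasure n)) {κ : ℝ} (hκ0 : 0 ≤ κ)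
    (hκ1 : κ * (1 + 1 / (4 * Real.pi ^ 2)) < 1)
    (hκ : ∀ᵐ y ∂(cellMeasure n), ∑ s, (c s y - divCoeff n s) ^ 2 ≤ κ) :
    IsCoercive (jetForm c hc) := by
  -- By Poincaré, q bounds the squared jet norm relative to ‖Dw‖².
  set q := 1 + 1 / (4 * Real.pi ^ 2) with hq
  have hpi : 0 < 4 * Real.pi ^ 2 := by positivity
  have hq0 : 0 < q := by positivity
  set θ := Real.sqrt (κ * q) with hθ
  have hθ1 : θ < 1 := by
    rw [hθ, Real.sqrt_lt' one_pos]; simpa using hκ1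
  have hθ0 : 0 ≤ θ := Real.sqrt_nonneg _
  refine ⟨(1 - θ) / q, div_pos (by linarith) hq0, fun x => ?_⟩
  set G := ∑ i, ∑ j, ‖(x : Jet n) (.inr (i, j))‖ ^ 2 with hG
  have hG0 : 0 ≤ G := Finset.sum_nonneg fun _ _ => Finset.sum_nonneg fun _ _ => sq_nonneg _
  have hid := sum_norm_jacobian_sq x.2
  have hskew : 0 ≤ ∑ i, ∑ j, ‖jetSkew i j (x : Jet n)‖ ^ 2 :=
    Finset.sum_nonneg fun _ _ => Finset.sum_nonneg fun _ _ => sq_nonneg _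
  have hx : ‖(x : Jet n)‖ ^ 2 ≤ q * G := by
    rw [jet_norm_sq, ← hG, hq, add_mul, one_mul, add_comm]
    have := poincare_jet x.2
    rw [← hG] at this
    have : ∑ i, ‖(x : Jet n) (.inl i)‖ ^ 2 ≤ 1 / (4 * Real.pi ^ 2) * G := by
      rw [div_mul_eq_mul_div, one_mul, le_div_iff₀ hpi]
      linarith
    linarith
  have hd : ‖jetDiv n (x : Jet n)‖ ≤ Real.sqrt G := Real.le_sqrt_of_sq_le (by rw [← hG] at hid; linarith)
  have hT : ‖jetOp c hc (x : Jet n) - jetDiv n (x : Jet n)‖ ≤ θ * Real.sqrt G := by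
    rw [hθ, ← Real.sqrt_mul (by positivity)]
    refine Real.le_sqrt_of_sq_le ((norm_jetOp_sub_jetDiv_sq_le hc hκ _).trans ?_)
    rw [mul_assoc]
    exact mul_le_mul_of_nonneg_left hx hκ0
  have hin : -(θ * G) ≤ ⟪jetDiv n (x : Jet n), jetOp c hc (x : Jet n) - jetDiv n (x : Jet n)⟫_ℝ := by
    have h1 := abs_real_inner_le_norm (jetDiv n (x : Jet n))
      (jetOp c hc (x : Jet n) - jetDiv n (x : Jet n))
    have h2 := mul_le_mul hd hT (norm_nonneg _) (Real.sqrt_nonneg _)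
    have h3 := Real.mul_self_sqrt hG0
    have h4 := neg_abs_le ⟪jetDiv n (x : Jet n), jetOp c hc (x : Jet n) - jetDiv n (x : Jet n)⟫_ℝ
    nlinarith
  have hB : jetForm c hc x x =
      G + ⟪jetDiv n (x : Jet n), jetOp c hc (x : Jet n) - jetDiv n (x : Jet n)⟫_ℝ := by
    rw [jetForm_apply, inner_sub_right, real_inner_self_eq_norm_sq, hG, hid]
    simp only [real_inner_self_eq_norm_sq]
    ring
  rw [hB]
  have hxx : ‖x‖ * ‖x‖ ≤ q * G := by rw [← sq]; exact hx
  calc (1 - θ) / q * ‖x‖ * ‖x‖ = (1 - θ) / q * (‖x‖ * ‖x‖) := by ring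
    _ ≤ (1 - θ) / q * (q * G) :=
        mul_le_mul_of_nonneg_left hxx (div_nonneg (by linarith) hq0.le)
    _ = (1 - θ) * G := by field_simp
    _ ≤ _ := by linarith

/-- The Lax–Milgram theorem: existence and uniqueness of solutions of a coercive problem. -/
lemma exists_unique_of_isCoercive {V : Type*} [NormedAddCommGroup V] [InnerProductSpace ℝ V]
    [CompleteSpace V] {B : V →L[ℝ] V →L[ℝ] ℝ} (hB : IsCoercive B) (ℓ : V →L[ℝ] ℝ) :
    ∃! v, ∀ w, B v w = ℓ w := by
  refine ⟨hB.continuousLinearEquivOfBilin.symm ((InnerProductSpace.toDual ℝ V).symm ℓ),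
    fun w => ?_, fun v hv => ?_⟩
  · have := hB.continuousLinearEquivOfBilin_apply
      (hB.continuousLinearEquivOfBilin.symm ((InnerProductSpace.toDual ℝ V).symm ℓ)) w
    rw [ContinuousLinearEquiv.apply_symm_apply, InnerProductSpace.toDual_symm_apply] at this
    exact this.symm
  · rw [ContinuousLinearEquiv.eq_symm_apply]
    refine ext_inner_right ℝ fun w => ?_
    rw [hB.continuousLinearEquivOfBilin_apply, hv, InnerProductSpace.toDual_symm_apply]

/-! ### The Cordes condition and the renormalised coefficients. -/

/-- The renormalised coefficients `(b̃, Ã)`, indexed by the components of a jet. -/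
def renormCoeff (A : (Fin n → ℝ) → Matrix (Fin n) (Fin n) ℝ) (b : (Fin n → ℝ) → (Fin n → ℝ)) :
    JetIndex n → (Fin n → ℝ) → ℝ :=
  Sum.elim (fun i y => renormB A b y i) (fun p y => renormA A b y p.1 p.2)

lemma aestronglyMeasurable_renormCoeff {A : (Fin n → ℝ) → Matrix (Fin n) (Fin n) ℝ}
    {b : (Fin n → ℝ) → (Fin n → ℝ)} (hAB : SettingB A b) (s : JetIndex n) :
    AEStronglyMeasurable (renormCoeff A b s) (cellMeasure n) := by
  have hA : ∀ i j, AEMeasurable (fun x => A x i j) (cellMeasure n) := fun i j =>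
    (hAB.bounded_A i j).2.1.aemeasurable
  have hb : ∀ i, AEMeasurable (fun x => b x i) (cellMeasure n) := fun i =>
    (hAB.bounded_b i).2.1.aemeasurable
  have hg : AEMeasurable (gam A b) (cellMeasure n) := by
    unfold gam frob Matrix.trace dotProduct
    refine AEMeasurable.div ?_ (AEMeasurable.add ?_ ?_)
    · exact Finset.aemeasurable_fun_sum _ fun i _ => hA i i
    · exact Finset.aemeasurable_fun_sum _ fun i _ =>
        Finset.aemeasurable_fun_sum _ fun j _ => (hA i j).mul (hA i j)
    · exact Finset.aemeasurable_fun_sum _ fun i _ => (hb i).mul (hb i)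
  rcases s with i | ⟨i, j⟩
  · exact (hg.mul (hb i)).aestronglyMeasurable
  · exact (hg.mul (hA i j)).aestronglyMeasurable

/-- The algebraic consequence of the Cordes condition: the renormalised coefficients are close to
those of the divergence. -/
lemma sum_renorm_sub_sq_le {M : Matrix (Fin n) (Fin n) ℝ} {v : Fin n → ℝ} {δ : ℝ}
    (hδ : 0 < (n : ℝ) - 1 + δ) (ht : 0 < M.trace)
    (h : (frob M M + v ⬝ᵥ v) / M.trace ^ 2 ≤ 1 / ((n : ℝ) - 1 + δ)) (hS : 0 < frob M M + v ⬝ᵥ v) :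
    ∑ i, (M.trace / (frob M M + v ⬝ᵥ v) * v i) ^ 2 +
      ∑ i, ∑ j, (M.trace / (frob M M + v ⬝ᵥ v) * M i j - if i = j then 1 else 0) ^ 2 ≤ 1 - δ := by
  set t := M.trace with ht'
  set S := frob M M + v ⬝ᵥ v with hS'
  set γ := t / S with hγ
  have e1 : ∑ i, (γ * v i) ^ 2 = γ ^ 2 * (v ⬝ᵥ v) := by
    simp only [dotProduct, Finset.mul_sum]
    exact Finset.sum_congr rfl fun i _ => by ring
  have e2 : ∑ i, ∑ j, (γ * M i j - if i = j then 1 else 0) ^ 2 =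
      γ ^ 2 * frob M M - 2 * γ * t + n := by
    have : ∀ i, ∑ j, (γ * M i j - if i = j then 1 else 0) ^ 2 =
        γ ^ 2 * ∑ j, M i j * M i j - 2 * γ * M i i + 1 := by
      intro i
      have h1 : ∀ j, (γ * M i j - if i = j then 1 else 0) ^ 2 =
          γ ^ 2 * (M i j * M i j) - (if i = j then 2 * γ * M i j else 0) +
            (if i = j then 1 else 0) := by
        intro j
        split_ifs <;> ring
      simp only [h1, Finset.sum_add_distrib, Finset.sum_sub_distrib, Finset.mul_sum]
      simp
    simp only [this, Finset.sum_add_distrib, Finset.sum_sub_distrib, ← Finset.mul_sum]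
    simp [frob, ht', Matrix.trace]
  have e3 : (n : ℝ) - 1 + δ ≤ t ^ 2 / S := by
    rw [div_le_div_iff₀ (by positivity) hδ] at h
    rw [le_div_iff₀ hS]
    linarith
  -- The quantity to bound is γ²S - 2γt + n. Its minimum over γ is at γ = t/S, with value n - t²/S.
  have e4 : γ ^ 2 * S = t ^ 2 / S := by rw [hγ]; field_simp
  have e5 : γ * t = t ^ 2 / S := by rw [hγ]; ring
  rw [e1, e2]
  have : γ ^ 2 * (v ⬝ᵥ v) + (γ ^ 2 * frob M M - 2 * γ * t + n) =
      γ ^ 2 * S - 2 * (γ * t) + n := by rw [hS']; ring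
  rw [this, e4, e5]
  linarith

/-- Ellipticity makes the trace positive, so the Cordes condition yields the pointwise bound κ = 1 -
δ. -/
lemma SettingB.exists_renormCoeff_bound {A : (Fin n → ℝ) → Matrix (Fin n) (Fin n) ℝ}
    {b : (Fin n → ℝ) → (Fin n → ℝ)} (hn : 1 ≤ n) (hAB : SettingB A b) :
    ∃ κ : ℝ, 0 ≤ κ ∧ κ ≤ 1 ∧ κ * (1 + 1 / (4 * Real.pi ^ 2)) < 1 ∧
      ∀ᵐ y ∂(cellMeasure n), ∑ s, (renormCoeff A b s y - divCoeff n s) ^ 2 ≤ κ := by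
  obtain ⟨lam, Lam, hlam, -, hell⟩ := hAB.elliptic
  obtain ⟨δ, hδ1, hδ2, hcor⟩ := hAB.cordes
  have hn1 : (1 : ℝ) ≤ n := by exact_mod_cast hn
  have hpi : 0 < Real.pi ^ 2 := by positivity
  have hδ0 : 0 < δ := lt_of_le_of_lt (by positivity) hδ1
  refine ⟨1 - δ, by linarith, by linarith, ?_, ?_⟩
  -- The claim amounts to δ > 1/(1 + 4π²), which follows from δ > n/(n + π²) and n ≥ 1.
  · rw [div_lt_iff₀ (by positivity)] at hδ1
    have h1 : (1 - δ) * (1 + 1 / (4 * Real.pi ^ 2)) =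
        ((1 - δ) * (4 * Real.pi ^ 2 + 1)) / (4 * Real.pi ^ 2) := by field_simp
    rw [h1, div_lt_one (by positivity)]
    nlinarith
  · filter_upwards [ae_restrict_of_ae hell, ae_restrict_of_ae hcor] with y h1 h2
    have hdiag : ∀ i, lam ≤ A y i i := fun i => by
      have := (h1 (Pi.single i 1)).1
      simpa using this
    have ht : 0 < (A y).trace := by
      have : ∑ _i : Fin n, lam ≤ (A y).trace := Finset.sum_le_sum fun i _ => hdiag i
      rw [Finset.sum_const, Finset.card_univ, Fintype.card_fin, nsmul_eq_mul] at this
      nlinarith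
    have hS : 0 < frob (A y) (A y) + b y ⬝ᵥ b y := by
      have hb : 0 ≤ b y ⬝ᵥ b y := Finset.sum_nonneg fun i _ => mul_self_nonneg _
      have hA : A y ⟨0, hn⟩ ⟨0, hn⟩ * A y ⟨0, hn⟩ ⟨0, hn⟩ ≤ frob (A y) (A y) := by
        refine le_trans ?_ (Finset.single_le_sum (f := fun i => ∑ j, A y i j * A y i j)
          (fun i _ => Finset.sum_nonneg fun j _ => mul_self_nonneg _)
          (Finset.mem_univ (⟨0, hn⟩ : Fin n)))
        exact Finset.single_le_sum (f := fun j => A y ⟨0, hn⟩ j * A y ⟨0, hn⟩ j)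
          (fun j _ => mul_self_nonneg _) (Finset.mem_univ (⟨0, hn⟩ : Fin n))
      nlinarith [hdiag ⟨0, hn⟩]
    have := sum_renorm_sub_sq_le (by linarith) ht h2 hS
    rw [Fintype.sum_sum_type, Fintype.sum_prod_type]
    simpa [renormCoeff, divCoeff, renormA, renormB, gam] using this

/-- Boundedness is read off from the Cordes bound: each coefficient lies within distance 1 of 0 or
1, whence the constant 2. -/
lemma SettingB.memLp_renormCoeff {A : (Fin n → ℝ) → Matrix (Fin n) (Fin n) ℝ}
    {b : (Fin n → ℝ) → (Fin n → ℝ)} (hn : 1 ≤ n) (hAB : SettingB A b) (s : JetIndex n) :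
    MemLp (renormCoeff A b s) ⊤ (cellMeasure n) := by
  obtain ⟨κ, -, hκ, -, h⟩ := hAB.exists_renormCoeff_bound hn
  refine MemLp.of_bound (aestronglyMeasurable_renormCoeff hAB s) 2 ?_
  filter_upwards [h] with y hy
  have h1 : (renormCoeff A b s y - divCoeff n s) ^ 2 ≤ 1 :=
    (Finset.single_le_sum (f := fun s => (renormCoeff A b s y - divCoeff n s) ^ 2)
      (fun _ _ => sq_nonneg _) (Finset.mem_univ s)).trans (hy.trans hκ)
  have h2 : 0 ≤ divCoeff n s ∧ divCoeff n s ≤ 1 := by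
    rcases s with i | p
    · simp [divCoeff]
    · simp only [divCoeff, Sum.elim_inr]; split_ifs <;> simp
  rw [Real.norm_eq_abs, abs_le]
  have := abs_le.mp ((sq_le_one_iff_abs_le_one _).mp h1)
  constructor <;> linarith [this.1, this.2, h2.1, h2.2]

/-! ### Vector fields and their jets. -/

/-- The jet of a vector field. -/
def toJet (w : (Fin n → ℝ) → (Fin n → ℝ)) : Jet n :=
  WithLp.toLp 2 (Sum.elim (fun i => cellLp fun y => w y i)
    fun p => cellLp (weakPartial p.2 fun y => w y p.1))

@[simp] lemma toJet_inl (w : (Fin n → ℝ) → (Fin n → ℝ)) (i : Fin n) :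
    toJet w (.inl i) = cellLp fun y => w y i := rfl

@[simp] lemma toJet_inr (w : (Fin n → ℝ) → (Fin n → ℝ)) (i j : Fin n) :
    toJet w (.inr (i, j)) = cellLp (weakPartial j fun y => w y i) := rfl

lemma MemH1PerZeroVec.toJet_mem {w : (Fin n → ℝ) → (Fin n → ℝ)} (hw : MemH1PerZeroVec w) :
    toJet w ∈ sobolevJets n :=
  ⟨fun i j => (hw i).1.isPartial j, fun i => by
    rw [fourierCf_zero, toJet_inl, integral_cellLp (hw i).1.1.2, (hw i).2, Complex.ofReal_zero]⟩

/-- The periodic vector field with a given jet. -/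
def ofJet (x : Jet n) (y : Fin n → ℝ) : Fin n → ℝ := fun i => perExt (x (.inl i)) y

lemma ofJet_isPartial {x : Jet n} (hx : x ∈ sobolevJets n) (i j : Fin n) :
    IsPartial j (cellLp fun y => ofJet x y i) (x (.inr (i, j))) := by
  have : cellLp (fun y => ofJet x y i) = x (.inl i) := cellLp_perExt _
  rw [this]
  exact hx.1 i j

lemma memH1PerZeroVec_ofJet {x : Jet n} (hx : x ∈ sobolevJets n) : MemH1PerZeroVec (ofJet x) := by
  refine fun i => ⟨memH1Per_of_isPartial (memLpPer_perExt _) (ofJet_isPartial hx i), ?_⟩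
  change ∫ y in unitCell n, perExt (x (.inl i)) y = 0
  rw [← integral_cellLp (memLpPer_perExt _).2, cellLp_perExt]
  have := hx.2 i
  rw [fourierCf_zero] at this
  exact_mod_cast this

lemma toJet_ofJet {x : Jet n} (hx : x ∈ sobolevJets n) : toJet (ofJet x) = x := by
  ext1 s
  rcases s with i | ⟨i, j⟩
  · exact cellLp_perExt _
  · exact (ofJet_isPartial hx i j).cellLp_weakPartial (memLpPer_perExt _).2

lemma ae_eq_of_toJet_eq {v w : (Fin n → ℝ) → (Fin n → ℝ)} (hv : MemH1PerZeroVec v)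
    (hw : MemH1PerZeroVec w) (h : toJet v = toJet w) : v =ᵐ[volume] w := by
  refine YPeriodic.ae_eq (fun x k => funext fun i => (hv i).1.1.1 x k)
    (fun x k => funext fun i => (hw i).1.1.1 x k) ?_
  have : ∀ᵐ y ∂(cellMeasure n), ∀ i, v y i = w y i := by
    rw [ae_all_iff]
    intro i
    have e : cellLp (fun y => v y i) = cellLp fun y => w y i :=
      congrArg (fun x : Jet n => x (.inl i)) h
    filter_upwards [coeFn_cellLp (hv i).1.1.2, coeFn_cellLp (hw i).1.1.2] with y h1 h2
    rw [← h1, ← h2, e]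
  filter_upwards [this] with y hy
  exact funext hy

lemma memLpPer_weakDiv (w : (Fin n → ℝ) → (Fin n → ℝ)) : MemLpPer 2 (weakDiv w) :=
  ⟨fun x k => Finset.sum_congr rfl fun i _ => (memLpPer_weakPartial i _).1 x k,
    memLp_finsetSum _ fun i _ => (memLpPer_weakPartial i _).2⟩

lemma cellLp_weakDiv (w : (Fin n → ℝ) → (Fin n → ℝ)) : cellLp (weakDiv w) = jetDiv n (toJet w) := by
  rw [jetDiv_apply]
  refine cellLp_eq ?_
  filter_upwards [coeFn_sum Finset.univ fun i => toJet w (.inr (i, i)),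
    ae_all_iff.mpr fun i => coeFn_cellLp (memLpPer_weakPartial i fun y => w y i).2] with y h1 h2
  rw [h1]
  exact Finset.sum_congr rfl fun i _ => h2 i

lemma MemH1PerZeroVec.integral_weakDiv {w : (Fin n → ℝ) → (Fin n → ℝ)} (hw : MemH1PerZeroVec w) :
    ∫ x in unitCell n, weakDiv w x = 0 := by
  unfold weakDiv
  rw [integral_finsetSum _ fun i _ => (memLpPer_weakPartial i _).2.integrable (by norm_num)]
  refine Finset.sum_eq_zero fun i _ => ?_
  rw [← integral_cellLp (memLpPer_weakPartial i _).2]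
  exact ((hw i).1.isPartial i).integral_eq_zero

/-! ### The operator and the form `B2` in terms of jets. -/

section Coefficients

variable {A : (Fin n → ℝ) → Matrix (Fin n) (Fin n) ℝ} {b : (Fin n → ℝ) → (Fin n → ℝ)}

lemma coeFn_jetOp_toJet (hc : ∀ s, MemLp (renormCoeff A b s) ⊤ (cellMeasure n))
    {w : (Fin n → ℝ) → (Fin n → ℝ)} (hw : ∀ i, MemLpPer 2 fun y => w y i) :
    jetOp _ hc (toJet w) =ᵐ[cellMeasure n] fun y =>
      frob (renormA A b y) (weakJac w y) + renormB A b y ⬝ᵥ w y := by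
  filter_upwards [coeFn_jetOp hc (toJet w),
    ae_all_iff.mpr fun i => coeFn_cellLp (hw i).2,
    ae_all_iff.mpr fun i => ae_all_iff.mpr fun j =>
      coeFn_cellLp (memLpPer_weakPartial j fun y => w y i).2] with y h1 h2 h3
  rw [h1, Fintype.sum_sum_type, Fintype.sum_prod_type, add_comm]
  simp [toJet_inl, toJet_inr, h2, h3, renormCoeff, frob, weakJac, dotProduct]

lemma inner_jetOp_toJet (hc : ∀ s, MemLp (renormCoeff A b s) ⊤ (cellMeasure n))
    {w : (Fin n → ℝ) → (Fin n → ℝ)} (hw : ∀ i, MemLpPer 2 fun y => w y i)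
    {u : (Fin n → ℝ) → ℝ} (hu : MemLp u 2 (cellMeasure n)) :
    ⟪cellLp u, jetOp _ hc (toJet w)⟫_ℝ = ∫ y in unitCell n, u y *
      (frob (renormA A b y) (weakJac w y) + renormB A b y ⬝ᵥ w y) := by
  rw [L2.inner_def]
  refine integral_congr_ae ?_
  filter_upwards [coeFn_jetOp_toJet hc hw, coeFn_cellLp hu] with y h1 h2
  rw [h1, h2]
  simp [mul_comm]

lemma B2_eq_jetForm (hc : ∀ s, MemLp (renormCoeff A b s) ⊤ (cellMeasure n))
    {v w : (Fin n → ℝ) → (Fin n → ℝ)} (hv : MemH1PerZeroVec v) (hw : MemH1PerZeroVec w) :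
    B2 A b v w = jetForm _ hc ⟨toJet v, hv.toJet_mem⟩ ⟨toJet w, hw.toJet_mem⟩ := by
  rw [jetForm_apply]
  dsimp only
  rw [← cellLp_weakDiv, inner_jetOp_toJet hc (fun i => (hw i).1.1) (memLpPer_weakDiv v).2, B2]
  congr 2
  have hint : ∀ i j, Integrable (fun y => ⟪jetSkew i j (toJet v) y, jetSkew i j (toJet w) y⟫_ℝ)
      (cellMeasure n) := fun i j => L2.integrable_inner _ _
  simp only [L2.inner_def]
  simp only [← integral_finsetSum _ fun j _ => hint _ j]
  rw [← integral_finsetSum _ fun i _ => integrable_finsetSum _ fun j _ => hint i j]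
  refine integral_congr_ae ?_
  have hs : ∀ u : (Fin n → ℝ) → (Fin n → ℝ), ∀ᵐ y ∂(cellMeasure n), ∀ i j,
      jetSkew i j (toJet u) y = weakPartial j (fun y => u y i) y - weakPartial i (fun y => u y j) y := by
    intro u
    rw [ae_all_iff]
    intro i
    rw [ae_all_iff]
    intro j
    rw [jetSkew_apply]
    filter_upwards [Lp.coeFn_sub (toJet u (.inr (i, j))) (toJet u (.inr (j, i))),
      coeFn_cellLp (memLpPer_weakPartial j fun y => u y i).2,
      coeFn_cellLp (memLpPer_weakPartial i fun y => u y j).2] with y h1 h2 h3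
    rw [h1, Pi.sub_apply, toJet_inr, toJet_inr, h2, h3]
  filter_upwards [hs v, hs w] with y h1 h2
  simp only [h1, h2, frob, weakJac, Matrix.sub_apply, Matrix.transpose_apply, Matrix.of_apply]
  refine Finset.sum_congr rfl fun i _ => Finset.sum_congr rfl fun j _ => ?_
  simp [mul_comm]

end Coefficients

/-! ### Linear operations on periodic functions, and gradients as test fields. -/

lemma MemLpPer.sub {u v : (Fin n → ℝ) → ℝ} (hu : MemLpPer 2 u) (hv : MemLpPer 2 v) :
    MemLpPer 2 fun x => u x - v x :=
  ⟨fun x k => by simp only [hu.1 x k, hv.1 x k], hu.2.sub hv.2⟩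

lemma MemLpPer.add {u v : (Fin n → ℝ) → ℝ} (hu : MemLpPer 2 u) (hv : MemLpPer 2 v) :
    MemLpPer 2 fun x => u x + v x :=
  ⟨fun x k => by simp only [hu.1 x k, hv.1 x k], hu.2.add hv.2⟩

lemma MemLpPer.const_mul {u : (Fin n → ℝ) → ℝ} (hu : MemLpPer 2 u) (c : ℝ) :
    MemLpPer 2 fun x => c * u x :=
  ⟨fun x k => by simp only [hu.1 x k], hu.2.const_mul c⟩

lemma memLpPer_const (c : ℝ) : MemLpPer (n := n) 2 fun _ => c :=
  ⟨fun _ _ => rfl, memLp_const c⟩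

lemma cellLp_sub {u v : (Fin n → ℝ) → ℝ} (hu : MemLpPer 2 u) (hv : MemLpPer 2 v) :
    cellLp (fun x => u x - v x) = cellLp u - cellLp v :=
  cellLp_eq ((Lp.coeFn_sub _ _).trans ((coeFn_cellLp hu.2).sub (coeFn_cellLp hv.2)))

lemma cellLp_add {u v : (Fin n → ℝ) → ℝ} (hu : MemLpPer 2 u) (hv : MemLpPer 2 v) :
    cellLp (fun x => u x + v x) = cellLp u + cellLp v :=
  cellLp_eq ((Lp.coeFn_add _ _).trans ((coeFn_cellLp hu.2).add (coeFn_cellLp hv.2)))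

lemma cellLp_const_mul {u : (Fin n → ℝ) → ℝ} (hu : MemLpPer 2 u) (c : ℝ) :
    cellLp (fun x => c * u x) = c • cellLp u :=
  cellLp_eq ((Lp.coeFn_smul _ _).trans ((coeFn_cellLp hu.2).const_smul c))

lemma MemLpPer.integrable {u : (Fin n → ℝ) → ℝ} (hu : MemLpPer 2 u) :
    Integrable u (cellMeasure n) :=
  hu.2.integrable (by norm_num)

lemma MemH2Per.memH1PerZeroVec_weakGrad {φ : (Fin n → ℝ) → ℝ} (hφ : MemH2Per φ) :
    MemH1PerZeroVec (weakGrad φ) := fun i => ⟨hφ.2 i, by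
  change ∫ x in unitCell n, weakPartial i φ x = 0
  rw [← integral_cellLp (memLpPer_weakPartial i φ).2]
  exact (hφ.1.isPartial i).integral_eq_zero⟩

/-- Second weak derivatives commute; this is why gradient test fields do not see the skew term of
`B2`. -/
lemma MemH2Per.jetSkew_weakGrad {φ : (Fin n → ℝ) → ℝ} (hφ : MemH2Per φ) (i j : Fin n) :
    jetSkew i j (toJet (weakGrad φ)) = 0 := by
  rw [jetSkew_apply, sub_eq_zero]
  exact (hφ.1.isPartial i).comm ((hφ.2 i).isPartial j) (hφ.1.isPartial j) ((hφ.2 j).isPartial i)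

/-- Every mean zero function in `L²_per(Y)` is the Laplacian of some function in `H²_per(Y)`. -/
lemma exists_memH2Per_jetDiv_eq {u : (Fin n → ℝ) → ℝ} (hu : MemLpPer 2 u)
    (h0 : ∫ x in unitCell n, u x = 0) :
    ∃ φ, MemH2Per φ ∧ jetDiv n (toJet (weakGrad φ)) = cellLp u := by
  obtain ⟨ψ, w, h, hw, hh, hdiv⟩ := exists_poisson ((integral_cellLp hu.2).trans h0)
  have hψ : ∀ i, IsPartial i (cellLp (perExt ψ)) (w i) := fun i => by
    rw [cellLp_perExt]; exact hw i
  have e : ∀ i, cellLp (weakPartial i (perExt ψ)) = w i := fun i =>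
    (hψ i).cellLp_weakPartial (memLpPer_perExt ψ).2
  have hh' : ∀ i j, IsPartial j (cellLp (weakPartial i (perExt ψ))) (h i j) := fun i j => by
    rw [e]; exact hh i j
  refine ⟨perExt ψ, ⟨memH1Per_of_isPartial (memLpPer_perExt ψ) hψ, fun i =>
    memH1Per_of_isPartial (memLpPer_weakPartial i _) (hh' i)⟩, ?_⟩
  rw [jetDiv_apply, ← hdiv]
  exact Finset.sum_congr rfl fun i _ =>
    (hh' i i).cellLp_weakPartial (memLpPer_weakPartial i _).2

/-! ### Existence and uniqueness for the auxiliary and renormalised problems. -/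

section Coefficients

variable {A : (Fin n → ℝ) → Matrix (Fin n) (Fin n) ℝ} {b : (Fin n → ℝ) → (Fin n → ℝ)}

/-- The weak formulation of the renormalised problem in terms of jets. -/
lemma isFPKSolution_iff (hc : ∀ s, MemLp (renormCoeff A b s) ⊤ (cellMeasure n))
    {F : (Fin n → ℝ) → (Fin n → ℝ)} {u : (Fin n → ℝ) → ℝ} (hu : MemLpPer 2 u) :
    IsFPKSolution (renormA A b) (renormB A b) F u ↔ ∀ φ, MemH2Per φ →
      ⟪cellLp u, jetOp _ hc (toJet (weakGrad φ))⟫_ℝ =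
        ∫ x in unitCell n, F x ⬝ᵥ weakGrad φ x := by
  rw [IsFPKSolution, and_iff_right hu]
  refine forall_congr' fun φ => forall_congr' fun hφ => ?_
  rw [inner_jetOp_toJet hc (w := weakGrad φ) (fun i => (hφ.2 i).1) hu.2, ← integral_add]
  · simp only [mul_add]
    exact Iff.rfl
  · refine hu.2.integrable_mul (q := 2) (memLp_finsetSum _ fun i _ => memLp_finsetSum _ fun j _ => ?_)
    exact (memLpPer_weakPartial j (weakPartial i φ)).2.mul (p := ⊤) (hc (.inr (i, j)))
  · refine hu.2.integrable_mul (q := 2) (memLp_finsetSum _ fun i _ => ?_)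
    exact (hφ.2 i).1.2.mul (p := ⊤) (hc (.inl i))

/-- Existence for the auxiliary problem with a general right-hand side. -/
lemma exists_auxiliary (hc : ∀ s, MemLp (renormCoeff A b s) ⊤ (cellMeasure n))
    (hB : IsCoercive (jetForm _ hc)) (ℓ : Jet n →L[ℝ] ℝ) :
    ∃ ρ, MemH1PerZeroVec ρ ∧ ∀ w, MemH1PerZeroVec w → B2 A b ρ w = ℓ (toJet w) := by
  obtain ⟨x, hx, -⟩ := exists_unique_of_isCoercive hB (ℓ.comp (sobolevJets n).subtypeL)
  refine ⟨ofJet x, memH1PerZeroVec_ofJet x.2, fun w hw => ?_⟩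
  rw [B2_eq_jetForm hc (memH1PerZeroVec_ofJet x.2) hw]
  simp only [toJet_ofJet x.2, Subtype.coe_eta]
  exact hx _

/-- Uniqueness for the auxiliary problem. -/
lemma auxiliary_unique (hc : ∀ s, MemLp (renormCoeff A b s) ⊤ (cellMeasure n))
    (hB : IsCoercive (jetForm _ hc)) {ρ ρ' : (Fin n → ℝ) → (Fin n → ℝ)}
    (hρ : MemH1PerZeroVec ρ) (hρ' : MemH1PerZeroVec ρ')
    (h : ∀ w, MemH1PerZeroVec w → B2 A b ρ w = B2 A b ρ' w) : ρ =ᵐ[volume] ρ' := by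
  refine ae_eq_of_toJet_eq hρ hρ' ?_
  -- Both fields represent the functional B₂(ρ', ·), so Lax–Milgram identifies their jets.
  obtain ⟨z, -, hz⟩ := exists_unique_of_isCoercive hB (jetForm _ hc ⟨toJet ρ', hρ'.toJet_mem⟩)
  have h1 := hz ⟨toJet ρ, hρ.toJet_mem⟩ fun x => by
    have := h _ (memH1PerZeroVec_ofJet x.2)
    rw [B2_eq_jetForm hc hρ (memH1PerZeroVec_ofJet x.2),
      B2_eq_jetForm hc hρ' (memH1PerZeroVec_ofJet x.2)] at this
    simpa only [toJet_ofJet x.2, Subtype.coe_eta] using this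
  have h2 := hz ⟨toJet ρ', hρ'.toJet_mem⟩ fun x => rfl
  exact congrArg Subtype.val (h1.trans h2.symm)

/-- Testing with gradients only sees the divergence of the first argument of `B₂`. -/
lemma B2_weakGrad (hc : ∀ s, MemLp (renormCoeff A b s) ⊤ (cellMeasure n))
    {ρ : (Fin n → ℝ) → (Fin n → ℝ)} (hρ : MemH1PerZeroVec ρ) {φ : (Fin n → ℝ) → ℝ}
    (hφ : MemH2Per φ) : B2 A b ρ (weakGrad φ) =
      ⟪cellLp (weakDiv ρ), jetOp _ hc (toJet (weakGrad φ))⟫_ℝ := by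
  rw [B2_eq_jetForm hc hρ hφ.memH1PerZeroVec_weakGrad, jetForm_apply, cellLp_weakDiv]
  simp [hφ.jetSkew_weakGrad]

/-- A solution of the renormalised problem is determined by its mean. -/
lemma IsFPKSolution.ae_eq (hc : ∀ s, MemLp (renormCoeff A b s) ⊤ (cellMeasure n))
    (hB : IsCoercive (jetForm _ hc)) {F : (Fin n → ℝ) → (Fin n → ℝ)} {u v : (Fin n → ℝ) → ℝ}
    (hu : IsFPKSolution (renormA A b) (renormB A b) F u)
    (hv : IsFPKSolution (renormA A b) (renormB A b) F v)
    (huv : ∫ x in unitCell n, u x = ∫ x in unitCell n, v x) : u =ᵐ[volume] v := by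
  have h0 : ∫ x in unitCell n, (u x - v x) = 0 := by
    rw [integral_sub hu.1.integrable hv.1.integrable, huv, sub_self]
  -- Solve Δφ = u - v. Using φ as test function in both equations makes the form vanish at ∇φ.
  obtain ⟨φ, hφ, hdiv⟩ := exists_memH2Per_jetDiv_eq (hu.1.sub hv.1) h0
  set x : sobolevJets n := ⟨toJet (weakGrad φ), hφ.memH1PerZeroVec_weakGrad.toJet_mem⟩ with hx
  have hform : jetForm _ hc x x = 0 := by
    rw [jetForm_apply, hx]
    simp only [hφ.jetSkew_weakGrad, inner_zero_left, Finset.sum_const_zero, mul_zero, add_zero]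
    rw [hdiv, cellLp_sub hu.1 hv.1, inner_sub_left, (isFPKSolution_iff hc hu.1).mp hu φ hφ,
      (isFPKSolution_iff hc hv.1).mp hv φ hφ, sub_self]
  obtain ⟨C, hC, hCB⟩ := hB
  have hx0 : ‖x‖ = 0 := by
    have h1 := hCB x
    rw [hform] at h1
    by_contra hne
    have : 0 < ‖x‖ := lt_of_le_of_ne (norm_nonneg _) (Ne.symm hne)
    have : 0 < C * ‖x‖ * ‖x‖ := by positivity
    linarith
  have hx1 : toJet (weakGrad φ) = 0 := congrArg Subtype.val (norm_eq_zero.mp hx0)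
  rw [hx1, map_zero, cellLp_sub hu.1 hv.1, eq_comm, sub_eq_zero] at hdiv
  refine hu.1.1.ae_eq hv.1.1 ?_
  filter_upwards [coeFn_cellLp hu.1.2, coeFn_cellLp hv.1.2] with y h1 h2
  rw [← h1, ← h2, hdiv]

lemma IsFPKSolution.congr {F : (Fin n → ℝ) → (Fin n → ℝ)} {u v : (Fin n → ℝ) → ℝ}
    (hu : IsFPKSolution (renormA A b) (renormB A b) F u) (hv : MemLpPer 2 v)
    (h : v =ᵐ[volume] u) : IsFPKSolution (renormA A b) (renormB A b) F v := by
  have h' : v =ᵐ[cellMeasure n] u := ae_restrict_of_ae h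
  refine ⟨hv, fun φ hφ => ?_⟩
  rw [← hu.2 φ hφ]
  congr 1
  · exact integral_congr_ae (h'.mul (Filter.EventuallyEq.refl _ _))
  · exact integral_congr_ae (h'.mul (Filter.EventuallyEq.refl _ _))

/-- Solutions of the homogeneous problem may be added. -/
lemma IsFPKSolution.add_const_mul (hc : ∀ s, MemLp (renormCoeff A b s) ⊤ (cellMeasure n))
    {F : (Fin n → ℝ) → (Fin n → ℝ)} {u r : (Fin n → ℝ) → ℝ}
    (hu : IsFPKSolution (renormA A b) (renormB A b) F u)
    (hr : IsFPKSolution (renormA A b) (renormB A b) 0 r) (c : ℝ) :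
    IsFPKSolution (renormA A b) (renormB A b) F fun x => u x + c * r x := by
  refine (isFPKSolution_iff hc (hu.1.add (hr.1.const_mul c))).mpr fun φ hφ => ?_
  rw [cellLp_add hu.1 (hr.1.const_mul c), cellLp_const_mul hr.1, inner_add_left,
    real_inner_smul_left, (isFPKSolution_iff hc hu.1).mp hu φ hφ,
    (isFPKSolution_iff hc hr.1).mp hr φ hφ]
  simp

/-- Existence of the renormalised invariant function. -/
lemma exists_isRenormInvariant (hc : ∀ s, MemLp (renormCoeff A b s) ⊤ (cellMeasure n))
    (hB : IsCoercive (jetForm _ hc)) : ∃ r, IsRenormInvariant A b r := by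
  have h1 := memLpPer_const (n := n) 1
  -- The right-hand side is w ↦ ∫ (Ã:Dw + b̃·w), so ∇·ρ cancels the residual of the constant 1.
  -- Since ∇·ρ has mean zero, the total mass remains 1.
  obtain ⟨ρ, hρ, h⟩ := exists_auxiliary hc hB
    ((innerBilin n (cellLp fun _ => 1)).comp (jetOp _ hc))
  refine ⟨fun x => 1 - weakDiv ρ x, ?_, ?_⟩
  · refine (isFPKSolution_iff hc (h1.sub (memLpPer_weakDiv ρ))).mpr fun φ hφ => ?_
    have h2 := h _ hφ.memH1PerZeroVec_weakGrad
    rw [B2_weakGrad hc hρ hφ] at h2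
    rw [cellLp_sub h1 (memLpPer_weakDiv ρ), inner_sub_left, h2]
    simp [innerBilin]
  · rw [integral_sub h1.integrable (memLpPer_weakDiv ρ).integrable, hρ.integral_weakDiv]
    simp

/-- The pairing of a square integrable vector field with jets. -/
def jetPairing (F : (Fin n → ℝ) → (Fin n → ℝ)) : Jet n →L[ℝ] ℝ :=
  ∑ i, (innerBilin n (cellLp fun y => F y i)).comp (PiLp.proj 2 _ (.inl i))

lemma jetPairing_toJet {F w : (Fin n → ℝ) → (Fin n → ℝ)} (hF : MemL2PerVec F)
    (hw : MemH1PerZeroVec w) : jetPairing F (toJet w) = ∫ x in unitCell n, F x ⬝ᵥ w x := by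
  have h : jetPairing F (toJet w) = ∑ i, ⟪cellLp fun y => F y i, cellLp fun y => w y i⟫_ℝ := by
    simp [jetPairing, innerBilin, _root_.sum_apply]
  rw [h]
  simp only [inner_cellLp (hF _).2 (hw _).1.1.2]
  exact (integral_finsetSum _ fun i _ => (hF i).2.integrable_mul (hw i).1.1.2).symm

end Coefficients

end
end CordesFPK

/-! ### The theorem. -/

open CordesFPK
theorem theorem3p3 {n : ℕ} (hn : 1 ≤ n)
    (A : (Fin n → ℝ) → Matrix (Fin n) (Fin n) ℝ) (b F : (Fin n → ℝ) → (Fin n → ℝ))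
    (hAB : SettingB A b) (hF : MemL2PerVec F) :
    -- the problem that defines the reference function has a unique solution in `L^2_per(Y)`
    (∃ r, IsRenormInvariant A b r ∧ ∀ r', IsRenormInvariant A b r' → r' =ᵐ[volume] r) ∧
    -- (i)
    (∃ ρ, IsAuxSolution A b F ρ ∧ ∀ ρ', IsAuxSolution A b F ρ' → ρ' =ᵐ[volume] ρ) ∧
    ∀ r ρ, IsRenormInvariant A b r → IsAuxSolution A b F ρ →
      -- (ii)
      ((IsFPKSolution (renormA A b) (renormB A b) F (fun x => - weakDiv ρ x) ∧
          ∫ x in unitCell n, - weakDiv ρ x = 0) ∧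
        ∀ u, IsFPKSolution (renormA A b) (renormB A b) F u → ∫ x in unitCell n, u x = 0 →
          u =ᵐ[volume] fun x => - weakDiv ρ x) ∧
      -- (iii)
      (∀ u, MemLpPer 2 u →
        (IsFPKSolution (renormA A b) (renormB A b) F u ↔
          ∃ c : ℝ, u =ᵐ[volume] fun x => - weakDiv ρ x + c * r x)) := by
  have hc := hAB.memLp_renormCoeff hn
  obtain ⟨κ, hκ0, -, hκ1, hκ⟩ := hAB.exists_renormCoeff_bound hn
  have hB : IsCoercive (jetForm _ hc) := isCoercive_jetForm hc hκ0 hκ1 hκ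
  refine ⟨?_, ?_, fun r ρ hr hρ => ?_⟩
  · obtain ⟨r, hr⟩ := exists_isRenormInvariant hc hB
    exact ⟨r, hr, fun r' hr' => hr'.1.ae_eq hc hB hr.1 (hr'.2.trans hr.2.symm)⟩
  · obtain ⟨ρ, hρ, h⟩ := exists_auxiliary hc hB (-jetPairing F)
    have hρF : IsAuxSolution A b F ρ := ⟨hρ, fun w hw => by
      rw [h w hw, _root_.neg_apply, jetPairing_toJet hF hw]⟩
    exact ⟨ρ, hρF, fun ρ' hρ' => auxiliary_unique hc hB hρ'.1 hρ fun w hw => by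
      rw [hρ'.2 w hw, hρF.2 w hw]⟩
  · have e : (fun x => - weakDiv ρ x) = fun x => (-1 : ℝ) * weakDiv ρ x := by
      funext x; ring
    have hper : MemLpPer 2 fun x => - weakDiv ρ x := by
      rw [e]; exact (memLpPer_weakDiv ρ).const_mul (-1)
    have hsol : IsFPKSolution (renormA A b) (renormB A b) F fun x => - weakDiv ρ x := by
      refine (isFPKSolution_iff hc hper).mpr fun φ hφ => ?_
      rw [e, cellLp_const_mul (memLpPer_weakDiv ρ), real_inner_smul_left,
        ← B2_weakGrad hc hρ.1 hφ, hρ.2 _ hφ.memH1PerZeroVec_weakGrad]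
      ring
    have hmean : ∫ x in unitCell n, - weakDiv ρ x = 0 := by
      rw [integral_neg, hρ.1.integral_weakDiv, neg_zero]
    refine ⟨⟨⟨hsol, hmean⟩, fun u hu hu0 => hu.ae_eq hc hB hsol (hu0.trans hmean.symm)⟩,
      fun u hu => ⟨fun h => ⟨∫ x in unitCell n, u x, ?_⟩, ?_⟩⟩
    -- The constant c must be the mean of u, because -∇·ρ has mean 0 and r has mean 1.
    · refine h.ae_eq hc hB (hsol.add_const_mul hc hr.1 _) ?_
      rw [integral_add hper.integrable (hr.1.1.const_mul _).integrable, hmean,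
        integral_const_mul, hr.2]
      ring
    · rintro ⟨c, h⟩
      exact (hsol.add_const_mul hc hr.1 c).congr hu h
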